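/- Let $k$ be an algebraically closed field of characteristic zero and let $L$ be a finite-dimensional simple Lie algebra over $k$ of type $G_2$, that is, whose root system $\Phi$ with respect to a Cartan subalgebra is of type $G_2$. Let $\{h_i\}\cup\{v_\alpha\}_{\alpha\in\Phi}$ be a Chevalley basis of $L$, let $L_{\mathbb Z}$ be its $\mathbb Z$-span (a Lie algebra over $\mathbb Z$), and for a field $F$ let $\mathfrak g_2(F)=L_{\mathbb Z}\otimes_{\mathbb Z}F$ be the corresponding Chevalley algebra over $F$. Let $F$ be a field of prime characteristic $p$. Then $\dim_F\mathfrak g_2(F)=14$, and every $F$-linear derivation of $\mathfrak g_2(F)$ is inner (that is, $\mathrm{ad}(\mathfrak g_2(F))=\mathrm{Der}(\mathfrak g_2(F))$) if and only if $p\neq 2$. If $p=2$, then the center of $\mathfrak g_2(F)$ is zero and $\dim_F\mathrm{Der}(\mathfrak g_2(F))=21$. -/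

import Mathlib

open scoped TensorProduct

/-- A Chevalley basis of a finite-dimensional semisimple Lie algebra `L` over an algebraically
closed field `k` of characteristic zero, relative to a Cartan subalgebra `H`. It consists of simple
roots `αᵢ` and of a basis `{hᵢ} ∪ {v_α}` of `L`, where `hᵢ` is the coroot of `αᵢ` and `v_α` is a
root vector for the root `α`. The structure constants are as usual: since `v_α` lies in the root
space of `α`, one has `⁅hᵢ, v_α⁆ = ⟨α, αᵢ⟩ v_α`; further `⁅v_α, v_(-α)⁆` is the coroot of `α`, and
`⁅v_α, v_β⁆ = ±(r + 1) v_(α + β)` whenever `α + β` is a root, where `β - r α, …, β + q α` is the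
`α`-string through `β`, and `⁅v_α, v_β⁆ = 0` if `α + β` is neither a root nor zero. -/
structure ChevalleyBasis {k L : Type*} [Field k] [IsAlgClosed k] [CharZero k] [LieRing L]
    [LieAlgebra k L] [FiniteDimensional k L] [LieAlgebra.IsSemisimple k L]
    (H : LieSubalgebra k L) [H.IsCartanSubalgebra] where
  /-- A system of simple roots. -/
  base : (LieAlgebra.IsKilling.rootSystem H).Base
  /-- The basis, indexed by the simple roots together with all the roots. -/
  toBasis : Module.Basis (base.support ⊕ H.root) k L
  toBasis_inl (i : base.support) :
    toBasis (Sum.inl i) = ((LieAlgebra.IsKilling.rootSystem H).coroot i : L)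
  toBasis_inr_mem (α : H.root) :
    toBasis (Sum.inr α) ∈ LieAlgebra.rootSpace H α.1
  lie_neg (α β : H.root)
    (h : (LieAlgebra.IsKilling.rootSystem H).root β =
      -(LieAlgebra.IsKilling.rootSystem H).root α) :
    ⁅toBasis (Sum.inr α), toBasis (Sum.inr β)⁆ =
      ((LieAlgebra.IsKilling.rootSystem H).coroot α : L)
  lie_add (α β γ : H.root)
    (h : (LieAlgebra.IsKilling.rootSystem H).root γ =
      (LieAlgebra.IsKilling.rootSystem H).root α + (LieAlgebra.IsKilling.rootSystem H).root β) :
    ⁅toBasis (Sum.inr α), toBasis (Sum.inr β)⁆ =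
        (((LieAlgebra.IsKilling.rootSystem H).chainBotCoeff α β : ℤ) + 1) •
          toBasis (Sum.inr γ) ∨
    ⁅toBasis (Sum.inr α), toBasis (Sum.inr β)⁆ =
        (-(((LieAlgebra.IsKilling.rootSystem H).chainBotCoeff α β : ℤ) + 1)) •
          toBasis (Sum.inr γ)
  lie_eq_zero (α β : H.root)
    (h₀ : (LieAlgebra.IsKilling.rootSystem H).root α +
      (LieAlgebra.IsKilling.rootSystem H).root β ≠ 0)
    (h : ∀ γ : H.root, (LieAlgebra.IsKilling.rootSystem H).root γ ≠
      (LieAlgebra.IsKilling.rootSystem H).root α + (LieAlgebra.IsKilling.rootSystem H).root β) :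
    ⁅toBasis (Sum.inr α), toBasis (Sum.inr β)⁆ = 0

namespace ChevalleyBasis

variable {k L : Type*} [Field k] [IsAlgClosed k] [CharZero k] [LieRing L]
  [LieAlgebra k L] [FiniteDimensional k L] [LieAlgebra.IsSemisimple k L]
  {H : LieSubalgebra k L} [H.IsCartanSubalgebra]

theorem coroot_mem_span (C : ChevalleyBasis H) (α : H.root) :
    ((LieAlgebra.IsKilling.rootSystem H).coroot α : L) ∈
      Submodule.span ℤ (Set.range C.toBasis) := by
  have h := Submodule.mem_map_of_mem (f := H.subtype.toAddMonoidHom.toIntLinearMap)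
    (C.base.coroot_mem_span_int α)
  rw [Submodule.map_span] at h
  refine Submodule.span_mono ?_ h
  rintro _ ⟨_, ⟨i, hi, rfl⟩, rfl⟩
  exact ⟨Sum.inl ⟨i, hi⟩, C.toBasis_inl ⟨i, hi⟩⟩

theorem lie_inl_inr (C : ChevalleyBasis H) (i : C.base.support) (α : H.root) :
    ⁅C.toBasis (Sum.inl i), C.toBasis (Sum.inr α)⁆ =
      (LieAlgebra.IsKilling.rootSystem H).pairingIn ℤ α i • C.toBasis (Sum.inr α) := by
  have h := LieAlgebra.IsKilling.lie_eq_smul_of_mem_rootSpace (C.toBasis_inr_mem α)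
    ((LieAlgebra.IsKilling.rootSystem H).coroot i)
  rw [C.toBasis_inl]
  refine h.trans ?_
  rw [← Int.cast_smul_eq_zsmul k]
  congr 1
  exact ((LieAlgebra.IsKilling.rootSystem H).algebraMap_pairingIn ℤ α i).symm

theorem lie_mem_span (C : ChevalleyBasis H) (s t : C.base.support ⊕ H.root) :
    ⁅C.toBasis s, C.toBasis t⁆ ∈ Submodule.span ℤ (Set.range C.toBasis) := by
  have hb (s) : C.toBasis s ∈ Submodule.span ℤ (Set.range C.toBasis) :=
    Submodule.subset_span ⟨s, rfl⟩
  rcases s with i | α <;> rcases t with j | β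
  · rw [C.toBasis_inl, C.toBasis_inl, ← LieSubalgebra.coe_bracket, trivial_lie_zero]
    exact zero_mem _
  · rw [C.lie_inl_inr]
    exact Submodule.smul_mem _ _ (hb _)
  · rw [← lie_skew, C.lie_inl_inr]
    exact neg_mem (Submodule.smul_mem _ _ (hb _))
  · by_cases h₀ : (LieAlgebra.IsKilling.rootSystem H).root α +
        (LieAlgebra.IsKilling.rootSystem H).root β = 0
    · rw [C.lie_neg α β (eq_neg_of_add_eq_zero_right h₀)]
      exact C.coroot_mem_span α
    · by_cases h : ∃ γ : H.root, (LieAlgebra.IsKilling.rootSystem H).root γ =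
        (LieAlgebra.IsKilling.rootSystem H).root α + (LieAlgebra.IsKilling.rootSystem H).root β
      · obtain ⟨γ, h⟩ := h
        rcases C.lie_add α β γ h with h | h <;> rw [h] <;> exact Submodule.smul_mem _ _ (hb _)
      · rw [C.lie_eq_zero α β h₀ (fun γ hγ => h ⟨γ, hγ⟩)]
        exact zero_mem _

/-- The `ℤ`-span `L_ℤ` of a Chevalley basis, a Lie algebra over `ℤ`. -/
def integralForm (C : ChevalleyBasis H) : LieSubalgebra ℤ L where
  __ := Submodule.span ℤ (Set.range C.toBasis)
  lie_mem' {x y} hx hy := by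
    change x ∈ Submodule.span ℤ (Set.range C.toBasis) at hx
    change y ∈ Submodule.span ℤ (Set.range C.toBasis) at hy
    change ⁅x, y⁆ ∈ Submodule.span ℤ (Set.range C.toBasis)
    induction hx using Submodule.span_induction with
    | mem x hx =>
      obtain ⟨s, rfl⟩ := hx
      induction hy using Submodule.span_induction with
      | mem y hy =>
        obtain ⟨t, rfl⟩ := hy
        exact C.lie_mem_span s t
      | zero => rw [lie_zero]; exact zero_mem _
      | add y z _ _ h₁ h₂ => rw [_root_.lie_add]; exact add_mem h₁ h₂
      | smul n y _ h => rw [lie_smul]; exact Submodule.smul_mem _ n h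
    | zero => rw [zero_lie]; exact zero_mem _
    | add x z _ _ h₁ h₂ => rw [add_lie]; exact add_mem h₁ h₂
    | smul n x _ h => rw [smul_lie]; exact Submodule.smul_mem _ n h

/-- The Chevalley algebra `L_F = F ⊗ L_ℤ` over a field `F`, with the bracket extended
`F`-bilinearly from the `ℤ`-span `L_ℤ` of the Chevalley basis. -/
abbrev chevalleyAlgebra (C : ChevalleyBasis H) (F : Type*) [Field F] : Type _ :=
  F ⊗[ℤ] C.integralForm

end ChevalleyBasis

namespace RootPairing.EmbeddedG2

variable {ι R M N : Type*} [CommRing R] [AddCommGroup M] [Module R M] [AddCommGroup N] [Module R N]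
  (P : RootPairing ι R M N) [P.EmbeddedG2]

/-- The coefficients of the positive roots followed by those of the negative roots. -/
def rootCoeff : Fin 12 → ℤ × ℤ :=
  ![(1, 0), (0, 1), (1, 1), (2, 1), (3, 1), (3, 2),
    (-1, 0), (0, -1), (-1, -1), (-2, -1), (-3, -1), (-3, -2)]

/-- The labelling of the roots corresponding to `rootCoeff`. -/
def rootLabel : Fin 12 → ι :=
  ![short P, long P, shortAddLong P, twoShortAddLong P, threeShortAddLong P,
    threeShortAddTwoLong P, P.reflectionPerm (short P) (short P),
    P.reflectionPerm (long P) (long P), P.reflectionPerm (shortAddLong P) (shortAddLong P),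
    P.reflectionPerm (twoShortAddLong P) (twoShortAddLong P),
    P.reflectionPerm (threeShortAddLong P) (threeShortAddLong P),
    P.reflectionPerm (threeShortAddTwoLong P) (threeShortAddTwoLong P)]

/-- The integral combination of the short and the long simple root with given coefficients. -/
def comb (x : ℤ × ℤ) : M := x.1 • P.root (short P) + x.2 • P.root (long P)

theorem comb_add (x y : ℤ × ℤ) : comb P (x + y) = comb P x + comb P y := by
  simp only [comb, Prod.fst_add, Prod.snd_add]; module

theorem comb_sub_nsmul (x y : ℤ × ℤ) (n : ℕ) :
    comb P (y - n • x) = comb P y - n • comb P x := by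
  simp only [comb, Prod.fst_sub, Prod.snd_sub, Prod.smul_fst, Prod.smul_snd]; module

variable [Finite ι] [CharZero R] [IsDomain R]

theorem comb_injective : Function.Injective (comb P) := by
  have hli := (linearIndependent_short_long P).restrict_scalars' ℤ
  rw [LinearIndependent.pair_iff] at hli
  intro x y hxy
  have := hli (x.1 - y.1) (x.2 - y.2) (by
    simp only [comb] at hxy
    rw [← sub_eq_zero] at hxy
    rw [← hxy]; module)
  exact Prod.ext (sub_eq_zero.1 this.1) (sub_eq_zero.1 this.2)

theorem root_rootLabel (s : Fin 12) : P.root (rootLabel P s) = comb P (rootCoeff s) := by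
  have h3 := shortAddLongRoot_eq P
  have h4 := twoShortAddLongRoot_eq P
  have h5 := threeShortAddLongRoot_eq P
  have h6 := threeShortAddTwoLongRoot_eq P
  have h2 : ∀ x : M, (2 : ℤ) • x = (2 : R) • x := fun x => by
    rw [← Int.cast_smul_eq_zsmul R]; norm_num
  have h3' : ∀ x : M, (3 : ℤ) • x = (3 : R) • x := fun x => by
    rw [← Int.cast_smul_eq_zsmul R]; norm_num
  have hneg (j : ι) : P.root (P.reflectionPerm j j) = -P.root j := by
    rw [root_reflectionPerm, reflection_apply_self]
  fin_cases s <;>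
    simp only [rootLabel, rootCoeff, comb, hneg, h3, h4, h5, h6, h2, h3', neg_add, Fin.zero_eta,
      Fin.mk_one,
      Fin.reduceFinMk, Matrix.cons_val, neg_smul, one_smul,
      zero_smul, zero_add, add_zero]

theorem rootLabel_injective : Function.Injective (rootLabel P) := by
  intro s t h
  have h := congrArg P.root h
  rw [root_rootLabel, root_rootLabel] at h
  exact (by decide : Function.Injective rootCoeff) (comb_injective P h)

variable [P.IsIrreducible]

theorem rootLabel_surjective : Function.Surjective (rootLabel P) := by
  intro i
  have h := mem_allRoots P i
  have hneg (j : ι) : -P.root j = P.root (P.reflectionPerm j j) := by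
    rw [root_reflectionPerm, reflection_apply_self]
  simp only [List.mem_cons, List.not_mem_nil, or_false, hneg,
    EmbeddingLike.apply_eq_iff_eq] at h
  rcases h with h | h | h | h | h | h | h | h | h | h | h | h
  exacts [⟨1, h.symm⟩, ⟨7, h.symm⟩, ⟨0, h.symm⟩, ⟨6, h.symm⟩, ⟨2, h.symm⟩, ⟨8, h.symm⟩,
    ⟨3, h.symm⟩, ⟨9, h.symm⟩, ⟨4, h.symm⟩, ⟨10, h.symm⟩, ⟨5, h.symm⟩, ⟨11, h.symm⟩]

theorem comb_mem_range_root_iff (x : ℤ × ℤ) :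
    comb P x ∈ Set.range P.root ↔ ∃ s, rootCoeff s = x := by
  constructor
  · rintro ⟨i, hi⟩
    obtain ⟨s, rfl⟩ := rootLabel_surjective P i
    rw [root_rootLabel] at hi
    exact ⟨s, comb_injective P hi⟩
  · rintro ⟨s, rfl⟩
    exact ⟨_, root_rootLabel P s⟩

theorem chainBotCoeff_rootLabel (s t : Fin 12) (n : ℕ)
    (hne : rootCoeff t ≠ rootCoeff s) (hneg : rootCoeff t ≠ -rootCoeff s)
    (h₁ : ∃ u, rootCoeff u = rootCoeff t - n • rootCoeff s)
    (h₂ : ∀ u, rootCoeff u ≠ rootCoeff t - (n + 1) • rootCoeff s) :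
    P.chainBotCoeff (rootLabel P s) (rootLabel P t) = n := by
  have : Module.IsReflexive R M := .of_isPerfPair P.toLinearMap
  have hli : LinearIndependent R ![P.root (rootLabel P s), P.root (rootLabel P t)] := by
    refine (IsReduced.linearIndependent_iff P).mpr ⟨fun h => ?_, fun h => ?_⟩
    · exact hne (by rw [rootLabel_injective P h])
    · rw [root_rootLabel, root_rootLabel] at h
      refine hneg ?_
      have : comb P (rootCoeff s) = comb P (-rootCoeff t) := by
        rw [h]; simp only [comb, Prod.fst_neg, Prod.snd_neg]; module
      rw [comb_injective P this, neg_neg]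
  have key (m : ℕ) : m ≤ P.chainBotCoeff (rootLabel P s) (rootLabel P t) ↔
      ∃ u, rootCoeff u = rootCoeff t - m • rootCoeff s := by
    rw [← root_sub_nsmul_mem_range_iff_le_chainBotCoeff hli, root_rootLabel, root_rootLabel,
      ← comb_sub_nsmul, comb_mem_range_root_iff]
  refine le_antisymm ?_ ((key n).2 h₁)
  by_contra! h
  obtain ⟨u, hu⟩ := (key (n + 1)).1 h
  exact h₂ u hu

end RootPairing.EmbeddedG2

/-- Weights of the elements `h₁, h₂, e₁, …, e₆, f₁, …, f₆` of the Lie algebra `𝔤₂`. -/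
def G2.weight : Fin 14 → ℤ × ℤ :=
  ![(0, 0), (0, 0), (1, 0), (0, 1), (1, 1), (2, 1), (3, 1), (3, 2),
    (-1, 0), (0, -1), (-1, -1), (-2, -1), (-3, -1), (-3, -2)]

/-- The brackets `[xᵢ, xⱼ]` of the standard basis elements `h₁, h₂, e₁, …, e₆, f₁, …, f₆` of `𝔤₂`,
as lists of basis elements with coefficients. -/
def G2.table : List (List (List (ℕ × ℤ))) :=
  [[[], [], [(2, 2)], [(3, -3)], [(4, -1)], [(5, 1)], [(6, 3)], [], [(8, -2)], [(9, 3)],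
    [(10, 1)], [(11, -1)], [(12, -3)], []],
   [[], [], [(2, -1)], [(3, 2)], [(4, 1)], [], [(6, -1)], [(7, 1)], [(8, 1)], [(9, -2)],
    [(10, -1)], [], [(12, 1)], [(13, -1)]],
   [[(2, -2)], [(2, 1)], [], [(4, -1)], [(5, 2)], [(6, 3)], [], [], [(0, 1)], [], [(9, -3)],
    [(10, 2)], [(11, 1)], []],
   [[(3, 3)], [(3, -2)], [(4, 1)], [], [], [], [(7, 1)], [], [], [(1, 1)], [(8, 1)], [], [],
    [(12, 1)]],
   [[(4, 1)], [(4, -1)], [(5, -2)], [], [], [(7, 3)], [], [], [(3, 3)], [(2, -1)],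
    [(0, -1), (1, -3)], [(8, 2)], [], [(11, -1)]],
   [[(5, -1)], [], [(6, -3)], [], [(7, -3)], [], [], [], [(4, -2)], [], [(2, -2)],
    [(0, 2), (1, 3)], [(8, -1)], [(10, -1)]],
   [[(6, -3)], [(6, 1)], [], [(7, -1)], [], [], [], [], [(5, -1)], [], [], [(2, 1)],
    [(0, -1), (1, -1)], [(9, 1)]],
   [[], [(7, -1)], [], [], [], [], [], [], [], [(6, -1)], [(5, 1)], [(4, 1)], [(3, -1)],
    [(0, 1), (1, 2)]],
   [[(8, 2)], [(8, -1)], [(0, -1)], [], [(3, -3)], [(4, 2)], [(5, 1)], [], [], [(10, -1)],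
    [(11, 2)], [(12, 3)], [], []],
   [[(9, -3)], [(9, 2)], [], [(1, -1)], [(2, 1)], [], [], [(6, 1)], [(10, 1)], [], [], [],
    [(13, 1)], []],
   [[(10, -1)], [(10, 1)], [(9, 3)], [(8, -1)], [(0, 1), (1, 3)], [(2, 2)], [], [(5, -1)],
    [(11, -2)], [], [], [(13, 3)], [], []],
   [[(11, 1)], [], [(10, -2)], [], [(8, -2)], [(0, -2), (1, -3)], [(2, -1)], [(4, -1)],
    [(12, -3)], [], [(13, -3)], [], [], []],
   [[(12, 3)], [(12, -1)], [(11, -1)], [], [], [(8, 1)], [(0, 1), (1, 1)], [(3, 1)], [],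
    [(13, -1)], [], [], [], []],
   [[], [(13, 1)], [], [(12, -1)], [(11, 1)], [(10, 1)], [(9, -1)], [(0, -1), (1, -2)], [], [],
    [], [], [], []]]

/-- The structure constants of `𝔤₂`. -/
def G2.structureConst (i j t : Fin 14) : ℤ :=
  (((G2.table.getD i []).getD j []).lookup (t : ℕ)).getD 0

/-- The bracket of `w i` and `w j` is as in the multiplication table of `𝔤₂`. -/
def G2.HasBracket (k : Type*) {L : Type*} [Field k] [LieRing L] [LieAlgebra k L]
    (w : Fin 14 → L) (i j : Fin 14) : Prop :=
  ⁅w i, w j⁆ = ∑ t, (G2.structureConst i j t : k) • w t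

namespace G2.HasBracket

variable {k L : Type*} [Field k] [LieRing L] [LieAlgebra k L] {w : Fin 14 → L}

theorem of_eq_smul {i j t : Fin 14} (n : ℤ) (h : ⁅w i, w j⁆ = (n : k) • w t)
    (hc : ∀ s, structureConst i j s = if s = t then n else 0) : HasBracket k w i j := by
  simp [HasBracket, h, hc, ite_smul]

theorem of_eq {i j t : Fin 14} (h : ⁅w i, w j⁆ = w t)
    (hc : ∀ s, structureConst i j s = if s = t then 1 else 0) : HasBracket k w i j :=
  of_eq_smul 1 (by simpa using h) hc

theorem of_eq_zero {i j : Fin 14} (h : ⁅w i, w j⁆ = 0)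
    (hc : ∀ s, structureConst i j s = 0) : HasBracket k w i j := by
  simp [HasBracket, h, hc]

theorem symm {i j : Fin 14} (h : HasBracket k w i j)
    (hc : ∀ s, structureConst j i s = -structureConst i j s) : HasBracket k w j i := by
  rw [HasBracket, ← lie_skew, h]
  simp [hc]

/-- If the brackets with `w a` and with `w b` are known, so are the brackets with `⁅w a, w b⁆`. -/
theorem of_lie_eq [CharZero k] {a b i : Fin 14} (q : ℤ) (hq : q ≠ 0)
    (hab : ⁅w a, w b⁆ = (q : k) • w i)
    (ha : ∀ x, HasBracket k w a x) (hb : ∀ x, HasBracket k w b x)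
    (hc : ∀ x s, q * structureConst i x s = ∑ t, (structureConst b x t * structureConst a t s -
      structureConst a x t * structureConst b t s)) (x : Fin 14) : HasBracket k w i x := by
  have hq' : (q : k) ≠ 0 := Int.cast_ne_zero.2 hq
  have h := lie_lie (w a) (w b) (w x)
  rw [hab, smul_lie, ha x, hb x, lie_sum, lie_sum] at h
  refine smul_right_injective L hq' (h.trans ?_)
  simp only [lie_smul, fun x => show ⁅w a, w x⁆ = _ from ha x,
    fun x => show ⁅w b, w x⁆ = _ from hb x, Finset.smul_sum, smul_smul]
  rw [Finset.sum_comm]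
  nth_rw 2 [Finset.sum_comm]
  rw [← Finset.sum_sub_distrib]
  refine Finset.sum_congr rfl fun s _ => ?_
  rw [← Finset.sum_smul, ← Finset.sum_smul, ← sub_smul, ← Finset.sum_sub_distrib]
  congr 1
  exact_mod_cast (hc x s).symm

end G2.HasBracket

/-- Relations from which the multiplication table of `𝔤₂` follows. -/
structure IsG2System (k : Type*) {L : Type*} [Field k] [LieRing L] [LieAlgebra k L]
    (w : Fin 14 → L) : Prop where
  lie_h₁ (s : Fin 14) : ⁅w 0, w s⁆ = ((2 * (G2.weight s).1 - 3 * (G2.weight s).2 : ℤ) : k) • w s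
  lie_h₂ (s : Fin 14) : ⁅w 1, w s⁆ = ((-(G2.weight s).1 + 2 * (G2.weight s).2 : ℤ) : k) • w s
  lie_zero (s t : Fin 14) (hs : 1 < s) (ht : 1 < t)
    (h : ∀ u, G2.weight u ≠ G2.weight s + G2.weight t) : ⁅w s, w t⁆ = 0
  lie_e₁_f₁ : ⁅w 2, w 8⁆ = w 0
  lie_e₂_f₂ : ⁅w 3, w 9⁆ = w 1
  lie_e₂_e₁ : ⁅w 3, w 2⁆ = w 4
  lie_e₁_e₃ : ⁅w 2, w 4⁆ = (2 : k) • w 5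
  lie_e₁_e₄ : ⁅w 2, w 5⁆ = (3 : k) • w 6
  lie_e₂_e₅ : ⁅w 3, w 6⁆ = w 7
  lie_f₂_f₁ : ⁅w 9, w 8⁆ = w 10
  lie_f₁_f₃ : ⁅w 8, w 10⁆ = (2 : k) • w 11
  lie_f₁_f₄ : ⁅w 8, w 11⁆ = (3 : k) • w 12
  lie_f₂_f₅ : ⁅w 9, w 12⁆ = w 13

namespace IsG2System

open G2

variable {k L : Type*} [Field k] [LieRing L] [LieAlgebra k L] {w : Fin 14 → L}

theorem lie_h₁_of (H : IsG2System k w) (s : Fin 14) (n : ℤ)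
    (h : 2 * (weight s).1 - 3 * (weight s).2 = n) : ⁅w 0, w s⁆ = (n : k) • w s :=
  h ▸ H.lie_h₁ s

theorem lie_h₂_of (H : IsG2System k w) (s : Fin 14) (n : ℤ)
    (h : -(weight s).1 + 2 * (weight s).2 = n) : ⁅w 1, w s⁆ = (n : k) • w s :=
  h ▸ H.lie_h₂ s

theorem hasBracket_h₁ (H : IsG2System k w) (s : Fin 14) : HasBracket k w 0 s :=
  .of_eq_smul _ (H.lie_h₁ s) (by revert s; decide +kernel)

theorem hasBracket_h₂ (H : IsG2System k w) (s : Fin 14) : HasBracket k w 1 s :=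
  .of_eq_smul _ (H.lie_h₂ s) (by revert s; decide +kernel)

theorem hasBracket_of_weight (H : IsG2System k w) (s t : Fin 14) (hs : 1 < s) (ht : 1 < t)
    (h : ∀ u, weight u ≠ weight s + weight t) : HasBracket k w s t :=
  .of_eq_zero (H.lie_zero s t hs ht h) (by revert s t; decide +kernel)

theorem lie_e₁_f₃ (H : IsG2System k w) : ⁅w 2, w 10⁆ = (-3 : k) • w 9 := by
  have h := leibniz_lie (w 2) (w 9) (w 8)
  rw [H.lie_f₂_f₁, H.lie_zero 2 9 (by decide) (by decide) (by decide), H.lie_e₁_f₁] at h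
  simp only [zero_lie] at h
  rw [← lie_skew (w 9) (w 0), H.lie_h₁_of 9 3 (by decide)] at h
  linear_combination (norm := (push_cast; module)) h

theorem lie_e₁_f₄ [CharZero k] (H : IsG2System k w) : ⁅w 2, w 11⁆ = (2 : k) • w 10 := by
  have h := leibniz_lie (w 2) (w 8) (w 10)
  rw [H.lie_f₁_f₃, H.lie_e₁_f₁, H.lie_e₁_f₃] at h
  simp only [lie_smul] at h
  rw [H.lie_h₁_of 10 1 (by decide), ← lie_skew (w 8) (w 9), H.lie_f₂_f₁] at h
  linear_combination (norm := (push_cast; module)) (2 : k)⁻¹ • h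

theorem lie_e₁_f₅ [CharZero k] (H : IsG2System k w) : ⁅w 2, w 12⁆ = w 11 := by
  have h := leibniz_lie (w 2) (w 8) (w 11)
  rw [H.lie_f₁_f₄, H.lie_e₁_f₁, H.lie_e₁_f₄] at h
  simp only [lie_smul] at h
  rw [H.lie_h₁_of 11 (-1) (by decide), H.lie_f₁_f₃] at h
  linear_combination (norm := (push_cast; module)) (3 : k)⁻¹ • h

theorem lie_e₂_f₃ (H : IsG2System k w) : ⁅w 3, w 10⁆ = w 8 := by
  have h := leibniz_lie (w 3) (w 9) (w 8)
  rw [H.lie_f₂_f₁, H.lie_e₂_f₂, H.lie_zero 3 8 (by decide) (by decide) (by decide)] at h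
  simp only [_root_.lie_zero] at h
  rw [H.lie_h₂_of 8 1 (by decide)] at h
  linear_combination (norm := (push_cast; module)) h

theorem lie_e₂_f₆ (H : IsG2System k w) : ⁅w 3, w 13⁆ = w 12 := by
  have h := leibniz_lie (w 3) (w 9) (w 12)
  rw [H.lie_f₂_f₅, H.lie_e₂_f₂, H.lie_zero 3 12 (by decide) (by decide) (by decide)] at h
  simp only [_root_.lie_zero] at h
  rw [H.lie_h₂_of 12 1 (by decide)] at h
  linear_combination (norm := (push_cast; module)) h

theorem lie_f₁_e₃ (H : IsG2System k w) : ⁅w 8, w 4⁆ = (-3 : k) • w 3 := by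
  have h := leibniz_lie (w 8) (w 3) (w 2)
  rw [H.lie_e₂_e₁, H.lie_zero 8 3 (by decide) (by decide) (by decide),
    ← lie_skew (w 8) (w 2), H.lie_e₁_f₁] at h
  simp only [zero_lie, lie_neg] at h
  rw [← lie_skew (w 3) (w 0), H.lie_h₁_of 3 (-3) (by decide)] at h
  linear_combination (norm := (push_cast; module)) h

theorem lie_f₁_e₄ [CharZero k] (H : IsG2System k w) : ⁅w 8, w 5⁆ = (2 : k) • w 4 := by
  have h := leibniz_lie (w 8) (w 2) (w 4)
  rw [H.lie_e₁_e₃, ← lie_skew (w 8) (w 2), H.lie_e₁_f₁, H.lie_f₁_e₃] at h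
  simp only [neg_lie, lie_smul] at h
  rw [H.lie_h₁_of 4 (-1) (by decide), ← lie_skew (w 2) (w 3), H.lie_e₂_e₁] at h
  linear_combination (norm := (push_cast; module)) (2 : k)⁻¹ • h

theorem lie_f₁_e₅ [CharZero k] (H : IsG2System k w) : ⁅w 8, w 6⁆ = w 5 := by
  have h := leibniz_lie (w 8) (w 2) (w 5)
  rw [H.lie_e₁_e₄, ← lie_skew (w 8) (w 2), H.lie_e₁_f₁, H.lie_f₁_e₄] at h
  simp only [neg_lie, lie_smul] at h
  rw [H.lie_h₁_of 5 1 (by decide), H.lie_e₁_e₃] at h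
  linear_combination (norm := (push_cast; module)) (3 : k)⁻¹ • h

theorem lie_f₂_e₃ (H : IsG2System k w) : ⁅w 9, w 4⁆ = w 2 := by
  have h := leibniz_lie (w 9) (w 3) (w 2)
  rw [H.lie_e₂_e₁, ← lie_skew (w 9) (w 3), H.lie_e₂_f₂,
    H.lie_zero 9 2 (by decide) (by decide) (by decide)] at h
  simp only [_root_.lie_zero, neg_lie] at h
  rw [H.lie_h₂_of 2 (-1) (by decide)] at h
  linear_combination (norm := (push_cast; module)) h

theorem lie_f₂_e₆ (H : IsG2System k w) : ⁅w 9, w 7⁆ = w 6 := by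
  have h := leibniz_lie (w 9) (w 3) (w 6)
  rw [H.lie_e₂_e₅, ← lie_skew (w 9) (w 3), H.lie_e₂_f₂,
    H.lie_zero 9 6 (by decide) (by decide) (by decide)] at h
  simp only [_root_.lie_zero, neg_lie] at h
  rw [H.lie_h₂_of 6 (-1) (by decide)] at h
  linear_combination (norm := (push_cast; module)) h

theorem hasBracket_e₁ [CharZero k] (H : IsG2System k w) (x : Fin 14) : HasBracket k w 2 x := by
  fin_cases x
  exacts [
    .symm (H.hasBracket_h₁ 2) (by decide +kernel),
    .symm (H.hasBracket_h₂ 2) (by decide +kernel),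
    .of_eq_zero (lie_self _) (by decide +kernel),
    .symm (.of_eq H.lie_e₂_e₁ (by decide +kernel)) (by decide +kernel),
    .of_eq_smul 2 (by simpa using H.lie_e₁_e₃) (by decide +kernel),
    .of_eq_smul 3 (by simpa using H.lie_e₁_e₄) (by decide +kernel),
    H.hasBracket_of_weight _ _ (by decide) (by decide) (by decide),
    H.hasBracket_of_weight _ _ (by decide) (by decide) (by decide),
    .of_eq H.lie_e₁_f₁ (by decide +kernel),
    H.hasBracket_of_weight _ _ (by decide) (by decide) (by decide),
    .of_eq_smul (-3) (by simpa using H.lie_e₁_f₃) (by decide +kernel),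
    .of_eq_smul 2 (by simpa using H.lie_e₁_f₄) (by decide +kernel),
    .of_eq H.lie_e₁_f₅ (by decide +kernel),
    H.hasBracket_of_weight _ _ (by decide) (by decide) (by decide)]

theorem hasBracket_e₂ (H : IsG2System k w) (x : Fin 14) : HasBracket k w 3 x := by
  fin_cases x
  exacts [
    .symm (H.hasBracket_h₁ 3) (by decide +kernel),
    .symm (H.hasBracket_h₂ 3) (by decide +kernel),
    .of_eq H.lie_e₂_e₁ (by decide +kernel),
    .of_eq_zero (lie_self _) (by decide +kernel),
    H.hasBracket_of_weight _ _ (by decide) (by decide) (by decide),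
    H.hasBracket_of_weight _ _ (by decide) (by decide) (by decide),
    .of_eq H.lie_e₂_e₅ (by decide +kernel),
    H.hasBracket_of_weight _ _ (by decide) (by decide) (by decide),
    H.hasBracket_of_weight _ _ (by decide) (by decide) (by decide),
    .of_eq H.lie_e₂_f₂ (by decide +kernel),
    .of_eq H.lie_e₂_f₃ (by decide +kernel),
    H.hasBracket_of_weight _ _ (by decide) (by decide) (by decide),
    H.hasBracket_of_weight _ _ (by decide) (by decide) (by decide),
    .of_eq H.lie_e₂_f₆ (by decide +kernel)]

theorem hasBracket_f₁ [CharZero k] (H : IsG2System k w) (x : Fin 14) : HasBracket k w 8 x := by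
  fin_cases x
  exacts [
    .symm (H.hasBracket_h₁ 8) (by decide +kernel),
    .symm (H.hasBracket_h₂ 8) (by decide +kernel),
    .symm (.of_eq H.lie_e₁_f₁ (by decide +kernel)) (by decide +kernel),
    H.hasBracket_of_weight _ _ (by decide) (by decide) (by decide),
    .of_eq_smul (-3) (by simpa using H.lie_f₁_e₃) (by decide +kernel),
    .of_eq_smul 2 (by simpa using H.lie_f₁_e₄) (by decide +kernel),
    .of_eq H.lie_f₁_e₅ (by decide +kernel),
    H.hasBracket_of_weight _ _ (by decide) (by decide) (by decide),
    .of_eq_zero (lie_self _) (by decide +kernel),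
    .symm (.of_eq H.lie_f₂_f₁ (by decide +kernel)) (by decide +kernel),
    .of_eq_smul 2 (by simpa using H.lie_f₁_f₃) (by decide +kernel),
    .of_eq_smul 3 (by simpa using H.lie_f₁_f₄) (by decide +kernel),
    H.hasBracket_of_weight _ _ (by decide) (by decide) (by decide),
    H.hasBracket_of_weight _ _ (by decide) (by decide) (by decide)]

theorem hasBracket_f₂ (H : IsG2System k w) (x : Fin 14) : HasBracket k w 9 x := by
  fin_cases x
  exacts [
    .symm (H.hasBracket_h₁ 9) (by decide +kernel),
    .symm (H.hasBracket_h₂ 9) (by decide +kernel),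
    H.hasBracket_of_weight _ _ (by decide) (by decide) (by decide),
    .symm (.of_eq H.lie_e₂_f₂ (by decide +kernel)) (by decide +kernel),
    .of_eq H.lie_f₂_e₃ (by decide +kernel),
    H.hasBracket_of_weight _ _ (by decide) (by decide) (by decide),
    H.hasBracket_of_weight _ _ (by decide) (by decide) (by decide),
    .of_eq H.lie_f₂_e₆ (by decide +kernel),
    .of_eq H.lie_f₂_f₁ (by decide +kernel),
    .of_eq_zero (lie_self _) (by decide +kernel),
    H.hasBracket_of_weight _ _ (by decide) (by decide) (by decide),
    H.hasBracket_of_weight _ _ (by decide) (by decide) (by decide),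
    .of_eq H.lie_f₂_f₅ (by decide +kernel),
    H.hasBracket_of_weight _ _ (by decide) (by decide) (by decide)]

theorem hasBracket [CharZero k] (H : IsG2System k w) (i j : Fin 14) : HasBracket k w i j := by
  have e₁ := H.hasBracket_e₁
  have e₂ := H.hasBracket_e₂
  have f₁ := H.hasBracket_f₁
  have f₂ := H.hasBracket_f₂
  have e₃ := HasBracket.of_lie_eq 1 (by decide) (by simpa using H.lie_e₂_e₁) e₂ e₁
    (by decide +kernel)
  have e₄ := HasBracket.of_lie_eq 2 (by decide) (by simpa using H.lie_e₁_e₃) e₁ e₃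
    (by decide +kernel)
  have e₅ := HasBracket.of_lie_eq 3 (by decide) (by simpa using H.lie_e₁_e₄) e₁ e₄
    (by decide +kernel)
  have e₆ := HasBracket.of_lie_eq 1 (by decide) (by simpa using H.lie_e₂_e₅) e₂ e₅
    (by decide +kernel)
  have f₃ := HasBracket.of_lie_eq 1 (by decide) (by simpa using H.lie_f₂_f₁) f₂ f₁
    (by decide +kernel)
  have f₄ := HasBracket.of_lie_eq 2 (by decide) (by simpa using H.lie_f₁_f₃) f₁ f₃
    (by decide +kernel)
  have f₅ := HasBracket.of_lie_eq 3 (by decide) (by simpa using H.lie_f₁_f₄) f₁ f₄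
    (by decide +kernel)
  have f₆ := HasBracket.of_lie_eq 1 (by decide) (by simpa using H.lie_f₂_f₅) f₂ f₅
    (by decide +kernel)
  revert j
  fin_cases i
  exacts [H.hasBracket_h₁, H.hasBracket_h₂, e₁, e₂, e₃, e₄, e₅, e₆, f₁, f₂, f₃, f₄, f₅, f₆]

end IsG2System

namespace RootPairing

variable {ι R M N : Type*} [CommRing R] [AddCommGroup M] [Module R M] [AddCommGroup N] [Module R N]
  (P : RootPairing ι R M N)

theorem coroot_reflectionPerm_mem [P.IsCrystallographic] {S : AddSubgroup N} {i j : ι}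
    (hi : P.coroot i ∈ S) (hj : P.coroot j ∈ S) : P.coroot (P.reflectionPerm i j) ∈ S := by
  have h : P.coroot (P.reflectionPerm i j) = P.coroot j - P.pairingIn ℤ i j • P.coroot i := by
    rw [coroot_reflectionPerm, coreflection_apply, ← Int.cast_smul_eq_zsmul R,
      root'_coroot_eq_pairing]
    congr 2
    exact (P.algebraMap_pairingIn ℤ i j).symm
  rw [h]
  exact sub_mem hj (zsmul_mem hi _)

namespace EmbeddedG2

variable [P.EmbeddedG2]

theorem coroot_rootLabel_mem {S : AddSubgroup N} (hα : P.coroot (short P) ∈ S)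
    (hβ : P.coroot (long P) ∈ S) (s : Fin 12) : P.coroot (rootLabel P s) ∈ S := by
  have h3 : P.coroot (shortAddLong P) ∈ S := P.coroot_reflectionPerm_mem hβ hα
  have h4 : P.coroot (twoShortAddLong P) ∈ S := P.coroot_reflectionPerm_mem hα h3
  have h5 : P.coroot (threeShortAddLong P) ∈ S := P.coroot_reflectionPerm_mem hα hβ
  have h6 : P.coroot (threeShortAddTwoLong P) ∈ S := P.coroot_reflectionPerm_mem hβ h5
  have hneg {i : ι} (h : P.coroot i ∈ S) := P.coroot_reflectionPerm_mem h h
  fin_cases s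
  exacts [hα, hβ, h3, h4, h5, h6, hneg hα, hneg hβ, hneg h3, hneg h4, hneg h5, hneg h6]

variable [Finite ι] [CharZero R] [IsDomain R]

theorem pairing_rootLabel_short (s : Fin 12) :
    P.pairing (rootLabel P s) (short P) =
      ((2 * (rootCoeff s).1 - 3 * (rootCoeff s).2 : ℤ) : R) := by
  rw [← root_coroot_eq_pairing, root_rootLabel, comb]
  simp [← Int.cast_smul_eq_zsmul R]
  ring

theorem pairing_rootLabel_long (s : Fin 12) :
    P.pairing (rootLabel P s) (long P) = ((-(rootCoeff s).1 + 2 * (rootCoeff s).2 : ℤ) : R) := by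
  rw [← root_coroot_eq_pairing, root_rootLabel, comb]
  simp [← Int.cast_smul_eq_zsmul R]
  ring

end EmbeddedG2

end RootPairing

namespace ChevalleyBasis

open RootPairing.EmbeddedG2 LieAlgebra.IsKilling

variable {k L : Type*} [Field k] [IsAlgClosed k] [CharZero k] [LieRing L]
  [LieAlgebra k L] [FiniteDimensional k L] [LieAlgebra.IsSemisimple k L]
  {H : LieSubalgebra k L} [H.IsCartanSubalgebra] (C : ChevalleyBasis H)
  [(rootSystem H).EmbeddedG2]

/-- The root vector with a given label in a Chevalley basis of type `G₂`. -/
noncomputable def rootVector (s : Fin 12) : L := C.toBasis (Sum.inr (rootLabel (rootSystem H) s))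

theorem lie_coroot_rootVector (i : H.root) (s : Fin 12) :
    ⁅((rootSystem H).coroot i : L), C.rootVector s⁆ =
      (rootSystem H).pairing (rootLabel (rootSystem H) s) i • C.rootVector s :=
  lie_eq_smul_of_mem_rootSpace (C.toBasis_inr_mem _) _

theorem lie_rootVector_neg (s t : Fin 12) (h : rootCoeff t = -rootCoeff s) :
    ⁅C.rootVector s, C.rootVector t⁆ =
      ((rootSystem H).coroot (rootLabel (rootSystem H) s) : L) := by
  refine C.lie_neg _ _ ?_
  rw [root_rootLabel, root_rootLabel, h]
  simp only [comb, Prod.fst_neg, Prod.snd_neg]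
  module

variable [(rootSystem H).IsIrreducible]

theorem lie_rootVector_eq_zero (s t : Fin 12) (h₀ : rootCoeff s + rootCoeff t ≠ 0)
    (h : ∀ u, rootCoeff u ≠ rootCoeff s + rootCoeff t) :
    ⁅C.rootVector s, C.rootVector t⁆ = 0 := by
  refine C.lie_eq_zero _ _ ?_ fun γ hγ => ?_
  · rw [root_rootLabel, root_rootLabel, ← comb_add]
    intro h
    exact h₀ (comb_injective (rootSystem H) (h.trans (by simp [comb])))
  · rw [root_rootLabel, root_rootLabel, ← comb_add] at hγ
    obtain ⟨u, hu⟩ := (comb_mem_range_root_iff _ _).1 ⟨γ, hγ⟩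
    exact h u hu

theorem lie_rootVector (s t u : Fin 12) (n : ℕ) (h : rootCoeff u = rootCoeff s + rootCoeff t)
    (hne : rootCoeff t ≠ rootCoeff s) (hneg : rootCoeff t ≠ -rootCoeff s)
    (h₁ : ∃ u, rootCoeff u = rootCoeff t - n • rootCoeff s)
    (h₂ : ∀ u, rootCoeff u ≠ rootCoeff t - (n + 1) • rootCoeff s) :
    ⁅C.rootVector s, C.rootVector t⁆ = ((n + 1 : ℕ) : k) • C.rootVector u ∨
      ⁅C.rootVector s, C.rootVector t⁆ = -(((n + 1 : ℕ) : k) • C.rootVector u) := by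
  have := C.lie_add (rootLabel _ s) (rootLabel _ t) (rootLabel _ u)
    (by rw [root_rootLabel, root_rootLabel, root_rootLabel, ← comb_add, h])
  rw [chainBotCoeff_rootLabel _ s t n hne hneg h₁ h₂, neg_smul, ← Int.cast_smul_eq_zsmul k] at this
  simpa [rootVector] using this

theorem inv_smul_lie_eq_or {s t u : Fin 12} {x y : L} (n : ℕ)
    (hx : x = C.rootVector s ∨ x = -C.rootVector s)
    (hy : y = C.rootVector t ∨ y = -C.rootVector t)
    (h : rootCoeff u = rootCoeff s + rootCoeff t)
    (hne : rootCoeff t ≠ rootCoeff s) (hneg : rootCoeff t ≠ -rootCoeff s)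
    (h₁ : ∃ u, rootCoeff u = rootCoeff t - n • rootCoeff s)
    (h₂ : ∀ u, rootCoeff u ≠ rootCoeff t - (n + 1) • rootCoeff s) :
    ((n + 1 : ℕ) : k)⁻¹ • ⁅x, y⁆ = C.rootVector u ∨
      ((n + 1 : ℕ) : k)⁻¹ • ⁅x, y⁆ = -C.rootVector u := by
  have hn : ((n + 1 : ℕ) : k) ≠ 0 := Nat.cast_ne_zero.2 n.succ_ne_zero
  rcases hx with rfl | rfl <;> rcases hy with rfl | rfl <;>
    rcases C.lie_rootVector s t u n h hne hneg h₁ h₂ with h | h <;>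
    simp only [neg_lie, _root_.lie_neg, h, smul_neg, neg_neg, inv_smul_smul₀ hn, true_or, or_true]

/-- The elements `e₁, …, e₆` determined by the simple root vectors `e₁` and `e₂`. -/
def _root_.G2.positivePart (k : Type*) {L : Type*} [Field k] [LieRing L] [LieAlgebra k L]
    (x y : L) : Fin 6 → L :=
  let e₃ := ⁅y, x⁆
  let e₄ := (2 : k)⁻¹ • ⁅x, e₃⁆
  let e₅ := (3 : k)⁻¹ • ⁅x, e₄⁆
  ![x, y, e₃, e₄, e₅, ⁅y, e₅⁆]

/-- Root vectors, equal to those of the Chevalley basis up to signs. -/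
noncomputable def signedRootVector : Fin 12 → L :=
  Fin.append (m := 6) (n := 6) (G2.positivePart k (C.rootVector 0) (C.rootVector 1))
    (G2.positivePart k (C.rootVector 6) (C.rootVector 7))

theorem signedRootVector_eq_or (s : Fin 12) :
    C.signedRootVector s = C.rootVector s ∨ C.signedRootVector s = -C.rootVector s := by
  have h0 : C.signedRootVector 0 = C.rootVector 0 ∨ C.signedRootVector 0 = -C.rootVector 0 :=
    .inl rfl
  have h1 : C.signedRootVector 1 = C.rootVector 1 ∨ C.signedRootVector 1 = -C.rootVector 1 :=
    .inl rfl
  have h6 : C.signedRootVector 6 = C.rootVector 6 ∨ C.signedRootVector 6 = -C.rootVector 6 :=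
    .inl rfl
  have h7 : C.signedRootVector 7 = C.rootVector 7 ∨ C.signedRootVector 7 = -C.rootVector 7 :=
    .inl rfl
  have one (x : L) : ((0 + 1 : ℕ) : k)⁻¹ • x = x := by simp
  have two (x : L) : ((1 + 1 : ℕ) : k)⁻¹ • x = (2 : k)⁻¹ • x := by norm_num
  have three (x : L) : ((2 + 1 : ℕ) : k)⁻¹ • x = (3 : k)⁻¹ • x := by norm_num
  have key {s t u : Fin 12} {x y : L} (n : ℕ) (hx : x = C.rootVector s ∨ x = -C.rootVector s)
      (hy : y = C.rootVector t ∨ y = -C.rootVector t)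
      (h : rootCoeff u = rootCoeff s + rootCoeff t ∧ rootCoeff t ≠ rootCoeff s ∧
        rootCoeff t ≠ -rootCoeff s ∧ (∃ u, rootCoeff u = rootCoeff t - n • rootCoeff s) ∧
        ∀ u, rootCoeff u ≠ rootCoeff t - (n + 1) • rootCoeff s) :=
    C.inv_smul_lie_eq_or n hx hy h.1 h.2.1 h.2.2.1 h.2.2.2.1 h.2.2.2.2
  have h2 := key (u := 2) 0 h1 h0 (by decide)
  rw [one] at h2
  have h3 := key (u := 3) 1 h0 h2 (by decide)
  rw [two] at h3
  have h4 := key (u := 4) 2 h0 h3 (by decide)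
  rw [three] at h4
  have h5 := key (u := 5) 0 h1 h4 (by decide)
  rw [one] at h5
  have h8 := key (u := 8) 0 h7 h6 (by decide)
  rw [one] at h8
  have h9 := key (u := 9) 1 h6 h8 (by decide)
  rw [two] at h9
  have h10 := key (u := 10) 2 h6 h9 (by decide)
  rw [three] at h10
  have h11 := key (u := 11) 0 h7 h10 (by decide)
  rw [one] at h11
  fin_cases s
  exacts [h0, h1, h2, h3, h4, h5, h6, h7, h8, h9, h10, h11]

/-- A generating system of the integral form that satisfies the standard relations of `𝔤₂`. -/
noncomputable def standardSystem : Fin 14 → L :=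
  Fin.append (m := 2) (n := 12)
    ![((rootSystem H).coroot (short (rootSystem H)) : L),
      ((rootSystem H).coroot (long (rootSystem H)) : L)]
    C.signedRootVector

theorem isG2System_standardSystem : IsG2System k C.standardSystem := by
  have index (s : Fin 14) : s = 0 ∨ s = 1 ∨ ∃ t : Fin 12, s = Fin.natAdd 2 t := by
    revert s; decide
  have root_index (s : Fin 14) (hs : 1 < s) : ∃ t : Fin 12, s = Fin.natAdd 2 t := by
    revert s; decide
  have weight (t : Fin 12) : G2.weight (Fin.natAdd 2 t) = rootCoeff t := by
    revert t; decide
  have eval (t : Fin 12) : C.standardSystem (Fin.natAdd 2 t) = C.signedRootVector t :=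
    Fin.append_right _ _ t
  have toral (i j : H.root) :
      ⁅((rootSystem H).coroot i : L), ((rootSystem H).coroot j : L)⁆ = 0 := by
    rw [← LieSubalgebra.coe_bracket, trivial_lie_zero, ZeroMemClass.coe_zero]
  refine ⟨fun s => ?_, fun s => ?_, fun s t hs ht h => ?_, ?_, ?_, ?_, ?_, ?_, ?_, ?_, ?_, ?_, ?_⟩
  · obtain rfl | rfl | ⟨t, rfl⟩ := index s
    · simp [G2.weight]
    · exact (toral _ _).trans (by simp [G2.weight])
    · rw [eval, weight, ← pairing_rootLabel_short (rootSystem H)]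
      have := C.lie_coroot_rootVector (short (rootSystem H)) t
      rcases C.signedRootVector_eq_or t with h | h <;> rw [h]
      · exact this
      · rw [_root_.lie_neg, smul_neg]; exact congrArg _ this
  · obtain rfl | rfl | ⟨t, rfl⟩ := index s
    · exact (toral _ _).trans (by simp [G2.weight])
    · simp [G2.weight]
    · rw [eval, weight, ← pairing_rootLabel_long (rootSystem H)]
      have := C.lie_coroot_rootVector (long (rootSystem H)) t
      rcases C.signedRootVector_eq_or t with h | h <;> rw [h]
      · exact this
      · rw [_root_.lie_neg, smul_neg]; exact congrArg _ this
  · obtain ⟨s, rfl⟩ := root_index s hs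
    obtain ⟨t, rfl⟩ := root_index t ht
    simp only [weight] at h
    have := C.lie_rootVector_eq_zero s t (fun h' => h 0 h'.symm)
      (fun u => weight u ▸ h (Fin.natAdd 2 u))
    rw [eval, eval]
    rcases C.signedRootVector_eq_or s with h | h <;>
      rcases C.signedRootVector_eq_or t with h' | h' <;> simp [h, h', this]
  · exact C.lie_rootVector_neg 0 6 (by decide)
  · exact C.lie_rootVector_neg 1 7 (by decide)
  · rfl
  · exact (smul_inv_smul₀ (two_ne_zero (α := k)) _).symm
  · exact (smul_inv_smul₀ (three_ne_zero (α := k)) _).symm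
  · rfl
  · rfl
  · exact (smul_inv_smul₀ (two_ne_zero (α := k)) _).symm
  · exact (smul_inv_smul₀ (three_ne_zero (α := k)) _).symm
  · rfl

theorem span_range_standardSystem :
    Submodule.span ℤ (Set.range C.standardSystem) = Submodule.span ℤ (Set.range C.toBasis) := by
  have eval (t : Fin 12) : C.standardSystem (Fin.natAdd 2 t) = C.signedRootVector t :=
    Fin.append_right _ _ t
  apply le_antisymm <;> rw [Submodule.span_le]
  · have index (s : Fin 14) : s = 0 ∨ s = 1 ∨ ∃ t : Fin 12, s = Fin.natAdd 2 t := by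
      revert s; decide
    rintro _ ⟨s, rfl⟩
    obtain rfl | rfl | ⟨t, rfl⟩ := index s
    · exact C.coroot_mem_span _
    · exact C.coroot_mem_span _
    · have hv : C.rootVector t ∈ Submodule.span ℤ (Set.range C.toBasis) :=
        Submodule.subset_span ⟨_, rfl⟩
      rw [eval]
      rcases C.signedRootVector_eq_or t with h | h <;> rw [h]
      exacts [hv, neg_mem hv]
  · rintro _ ⟨i | α, rfl⟩
    · rw [C.toBasis_inl]
      obtain ⟨s, hs⟩ := rootLabel_surjective (rootSystem H) i
      rw [← hs]
      refine coroot_rootLabel_mem (rootSystem H) (S := (Submodule.span ℤ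
        (Set.range C.standardSystem)).toAddSubgroup.comap H.toSubmodule.subtype.toAddMonoidHom)
        ?_ ?_ s
      · exact Submodule.subset_span ⟨0, rfl⟩
      · exact Submodule.subset_span ⟨1, rfl⟩
    · obtain ⟨t, rfl⟩ := rootLabel_surjective (rootSystem H) α
      have hv : C.signedRootVector t ∈ Submodule.span ℤ (Set.range C.standardSystem) :=
        Submodule.subset_span ⟨_, eval t⟩
      change C.rootVector t ∈ _
      rcases C.signedRootVector_eq_or t with h | h
      · rwa [← h]
      · rw [← neg_eq_iff_eq_neg.2 h]; exact neg_mem hv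

theorem span_range_standardSystem_eq_top :
    Submodule.span k (Set.range C.standardSystem) = ⊤ := by
  rw [eq_top_iff, ← C.toBasis.span_eq, Submodule.span_le]
  intro x hx
  have : x ∈ Submodule.span ℤ (Set.range C.standardSystem) := by
    rw [C.span_range_standardSystem]; exact Submodule.subset_span hx
  exact Submodule.span_subset_span ℤ k _ this

theorem finrank_eq_fourteen (C : ChevalleyBasis H) : Module.finrank k L = 14 := by
  have : (rootSystem H).IsG2 := inferInstance
  rw [Module.finrank_eq_nat_card_basis C.toBasis, Nat.card_sum,
    card_index_eq_twelve (rootSystem H), Nat.card_eq_fintype_card, Fintype.card_coe,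
    RootPairing.IsG2.card_base_support_eq_two]

theorem linearIndependent_standardSystem : LinearIndependent k C.standardSystem :=
  linearIndependent_of_top_le_span_of_card_eq_finrank C.span_range_standardSystem_eq_top.ge
    (by rw [C.finrank_eq_fourteen, Fintype.card_fin])

/-- The `ℤ`-basis of the integral form given by the standard generating system. -/
noncomputable def integralBasis : Module.Basis (Fin 14) ℤ C.integralForm :=
  (Module.Basis.span (C.linearIndependent_standardSystem.restrict_scalars' ℤ)).map
    (LinearEquiv.ofEq _ C.integralForm.toSubmodule C.span_range_standardSystem)

theorem coe_integralBasis (i : Fin 14) : (C.integralBasis i : L) = C.standardSystem i := by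
  exact congrArg Subtype.val <|
    Module.Basis.span_apply (C.linearIndependent_standardSystem.restrict_scalars' ℤ) i

theorem lie_integralBasis (i j : Fin 14) : ⁅C.integralBasis i, C.integralBasis j⁆ =
    ∑ t, G2.structureConst i j t • C.integralBasis t := by
  apply Subtype.ext
  have h := C.isG2System_standardSystem.hasBracket i j
  rw [G2.HasBracket] at h
  rw [LieSubalgebra.coe_bracket, coe_integralBasis, coe_integralBasis, h]
  have coe (x : C.integralForm) : (x : L) = (C.integralForm.incl : C.integralForm →ₗ[ℤ] L) x := rfl
  rw [coe, map_sum]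
  refine Finset.sum_congr rfl fun t _ => ?_
  rw [map_smul, Int.cast_smul_eq_zsmul]
  exact congrArg _ (C.coe_integralBasis t).symm

end ChevalleyBasis

namespace G2

/-- The coefficient at the matrix entry `v` of a linear endomorphism `D` of the `s`-th coordinate of
`D ⁅xₐ, x_b⁆ - ⁅xₐ, D x_b⁆ - ⁅D xₐ, x_b⁆`. -/
def leibnizCoeff (a b s : Fin 14) (v : Fin 14 × Fin 14) : ℤ :=
  (if v.2 = s then structureConst a b v.1 else 0) -
    (if v.1 = b then structureConst a v.2 s else 0) -
    (if v.1 = a then structureConst v.2 b s else 0)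

/-- The equations that express that a matrix is the matrix of a derivation. -/
def IsDerivationMatrix {F : Type*} [Ring F] (d : Fin 14 × Fin 14 → F) : Prop :=
  ∀ a b s, ∑ v, (leibnizCoeff a b s v : F) * d v = 0

/-- A check that the Leibniz equations `(a, b, s)`, taken in the order of the list, determine the
entries `(i, j)` to be zero one after the other, so that a derivation matrix with vanishing entries
at the known positions is zero. -/
def eliminates (vanishes isUnit : ℤ → Bool) :
    List (Fin 14 × Fin 14) → List (ℕ × ℕ × ℕ × ℕ × ℕ) → Bool
  | known, [] => (List.finRange 14).all fun i => (List.finRange 14).all fun j =>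
      known.contains (i, j)
  | known, (a, b, s, i, j) :: l =>
    let coeff := leibnizCoeff (Fin.ofNat 14 a) (Fin.ofNat 14 b) (Fin.ofNat 14 s)
    let negligible (v : Fin 14 × Fin 14) : Bool :=
      vanishes (coeff v) || v == (Fin.ofNat 14 i, Fin.ofNat 14 j) || known.contains v
    isUnit (coeff (Fin.ofNat 14 i, Fin.ofNat 14 j)) &&
      ((List.finRange 14).all fun x => negligible (x, Fin.ofNat 14 s) &&
        negligible (Fin.ofNat 14 a, x) && negligible (Fin.ofNat 14 b, x)) &&
      eliminates vanishes isUnit ((Fin.ofNat 14 i, Fin.ofNat 14 j) :: known) l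

theorem IsDerivationMatrix.eq_zero_of_eliminates {F : Type*} [Field F] {d : Fin 14 × Fin 14 → F}
    (hd : IsDerivationMatrix d) {vanishes isUnit : ℤ → Bool}
    (hv : ∀ n, vanishes n → (n : F) = 0) (hu : ∀ n, isUnit n → (n : F) ≠ 0)
    (l : List (ℕ × ℕ × ℕ × ℕ × ℕ)) (known : List (Fin 14 × Fin 14))
    (hknown : ∀ v ∈ known, d v = 0) (h : eliminates vanishes isUnit known l) : d = 0 := by
  induction l generalizing known with
  | nil =>
    simp only [eliminates, List.all_eq_true, List.mem_finRange, List.contains_iff_mem,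
      true_implies] at h
    exact funext fun v => hknown v (h v.1 v.2)
  | cons e l ih =>
    obtain ⟨a, b, s, i, j⟩ := e
    simp only [eliminates, Bool.and_eq_true, Bool.or_eq_true, List.all_eq_true, List.mem_finRange,
      List.contains_iff_mem, true_implies, beq_iff_eq] at h
    obtain ⟨⟨h₁, h₂⟩, h₃⟩ := h
    refine ih _ (fun v hv' => ?_) h₃
    rcases List.mem_cons.1 hv' with rfl | hv'
    · have key := hd (Fin.ofNat 14 a) (Fin.ofNat 14 b) (Fin.ofNat 14 s)
      rw [Finset.sum_eq_single (Fin.ofNat 14 i, Fin.ofNat 14 j) ?_ (by simp)] at key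
      · exact (mul_eq_zero.1 key).resolve_left (hu _ h₁)
      · rintro ⟨x, y⟩ - hne
        have h : leibnizCoeff (Fin.ofNat 14 a) (Fin.ofNat 14 b) (Fin.ofNat 14 s) (x, y) = 0 ∨
            (vanishes (leibnizCoeff (Fin.ofNat 14 a) (Fin.ofNat 14 b) (Fin.ofNat 14 s) (x, y)) ∨
              (x, y) = (Fin.ofNat 14 i, Fin.ofNat 14 j)) ∨ (x, y) ∈ known := by
          by_cases hs : y = Fin.ofNat 14 s
          · subst hs; exact .inr (h₂ x).1.1
          by_cases ha : x = Fin.ofNat 14 a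
          · subst ha; exact .inr (h₂ y).1.2
          by_cases hb : x = Fin.ofNat 14 b
          · subst hb; exact .inr (h₂ y).2
          · left; simp only [leibnizCoeff, hs, ha, hb, if_false, sub_zero]
        rcases h with h | (h | h) | h
        · rw [h, Int.cast_zero, zero_mul]
        · rw [hv _ h, zero_mul]
        · exact absurd h hne
        · rw [hknown _ h, mul_zero]
    · exact hknown v hv'

/-- Positions in which a derivation matrix of `𝔤₂` in characteristic different from two vanishes
only if it is zero. -/
def positions : Fin 14 → Fin 14 × Fin 14 :=
  ![(0, 2), (1, 3), (0, 4), (0, 5), (1, 6), (1, 7), (0, 8), (1, 9), (0, 10), (0, 11), (1, 12),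
   (1, 13), (2, 2), (3, 3)]

/-- Positions in which a derivation matrix of `𝔤₂` in characteristic two vanishes only if it is
zero. -/
def positionsTwo : Fin 21 → Fin 14 × Fin 14 :=
  ![(2, 13), (1, 13), (0, 12), (3, 11), (0, 11), (5, 3), (0, 10), (1, 8), (0, 9), (2, 2), (3, 3),
   (5, 5), (0, 3), (1, 2), (0, 4), (3, 5), (0, 5), (2, 7), (0, 6), (1, 7), (8, 7)]

/-- The elimination of a derivation matrix in characteristic different from two. -/
def eliminationSteps : List (ℕ × ℕ × ℕ × ℕ × ℕ) :=
  [(0, 1, 2, 1, 2), (0, 1, 3, 0, 3), (0, 1, 4, 1, 4), (0, 1, 5, 1, 5), (0, 1, 6, 0, 6),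
   (0, 1, 7, 0, 7), (0, 1, 8, 1, 8), (0, 1, 9, 0, 9), (0, 1, 10, 1, 10), (0, 1, 11, 1, 11),
   (0, 1, 12, 0, 12), (0, 1, 13, 0, 13), (0, 2, 0, 2, 0), (0, 2, 1, 2, 1), (0, 2, 5, 2, 5),
   (0, 2, 6, 2, 6), (0, 2, 7, 2, 7), (0, 2, 8, 2, 8), (0, 2, 9, 2, 9), (0, 2, 10, 2, 10),
   (0, 2, 13, 2, 13), (0, 3, 4, 3, 4), (0, 3, 5, 3, 5), (0, 3, 8, 3, 8), (0, 3, 10, 3, 10),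
   (0, 3, 11, 3, 11), (0, 4, 0, 4, 0), (0, 4, 1, 4, 1), (0, 4, 3, 4, 3), (0, 4, 5, 4, 5),
   (0, 4, 6, 4, 6), (0, 4, 7, 4, 7), (0, 4, 8, 4, 8), (0, 4, 9, 4, 9), (0, 4, 10, 4, 10),
   (0, 4, 12, 4, 12), (0, 4, 13, 4, 13), (0, 5, 0, 5, 0), (0, 5, 1, 5, 1), (0, 5, 2, 5, 2),
   (0, 5, 3, 5, 3), (0, 5, 4, 5, 4), (0, 5, 5, 0, 0), (0, 5, 6, 5, 6), (0, 5, 7, 5, 7),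
   (0, 5, 9, 5, 9), (0, 5, 11, 5, 11), (0, 5, 12, 5, 12), (0, 5, 13, 5, 13), (0, 6, 2, 6, 2),
   (0, 6, 4, 6, 4), (0, 6, 5, 6, 5), (0, 6, 6, 0, 1), (0, 6, 10, 6, 10), (0, 6, 11, 6, 11),
   (0, 7, 2, 7, 2), (0, 7, 4, 7, 4), (0, 7, 5, 7, 5), (0, 7, 8, 7, 8), (0, 7, 10, 7, 10),
   (0, 7, 11, 7, 11), (0, 8, 0, 8, 0), (0, 8, 1, 8, 1), (0, 8, 2, 8, 2), (0, 8, 3, 8, 3),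
   (0, 8, 4, 8, 4), (0, 8, 7, 8, 7), (0, 8, 11, 8, 11), (0, 8, 12, 8, 12), (0, 8, 13, 8, 13),
   (0, 9, 2, 9, 2), (0, 9, 4, 9, 4), (0, 9, 5, 9, 5), (0, 9, 10, 9, 10), (0, 9, 11, 9, 11),
   (0, 10, 0, 10, 0), (0, 10, 1, 10, 1), (0, 10, 2, 10, 2), (0, 10, 3, 10, 3), (0, 10, 4, 10, 4),
   (0, 10, 6, 10, 6), (0, 10, 7, 10, 7), (0, 10, 9, 10, 9), (0, 10, 11, 10, 11),
   (0, 10, 12, 10, 12), (0, 10, 13, 10, 13), (0, 11, 0, 11, 0), (0, 11, 1, 11, 1),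
   (0, 11, 3, 11, 3), (0, 11, 5, 11, 5), (0, 11, 6, 11, 6), (0, 11, 7, 11, 7), (0, 11, 8, 11, 8),
   (0, 11, 9, 11, 9), (0, 11, 10, 11, 10), (0, 11, 12, 11, 12), (0, 11, 13, 11, 13),
   (0, 12, 4, 12, 4), (0, 12, 5, 12, 5), (0, 12, 8, 12, 8), (0, 12, 10, 12, 10),
   (0, 12, 11, 12, 11), (0, 13, 2, 13, 2), (0, 13, 4, 13, 4), (0, 13, 5, 13, 5),
   (0, 13, 8, 13, 8), (0, 13, 10, 13, 10), (0, 13, 11, 13, 11), (1, 2, 4, 2, 4),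
   (1, 2, 11, 2, 11), (1, 2, 12, 2, 12), (1, 3, 0, 3, 0), (1, 3, 1, 3, 1), (1, 3, 7, 3, 7),
   (1, 3, 9, 3, 9), (1, 3, 12, 3, 12), (1, 4, 2, 4, 2), (1, 4, 11, 4, 11), (1, 5, 5, 1, 0),
   (1, 5, 8, 5, 8), (1, 5, 10, 5, 10), (1, 6, 0, 6, 0), (1, 6, 1, 6, 1), (1, 6, 6, 1, 1),
   (1, 6, 7, 6, 7), (1, 6, 8, 6, 8), (1, 6, 9, 6, 9), (1, 6, 12, 6, 12), (1, 7, 0, 7, 0),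
   (1, 7, 1, 7, 1), (1, 7, 3, 7, 3), (1, 7, 6, 7, 6), (1, 7, 13, 7, 13), (1, 8, 5, 8, 5),
   (1, 8, 6, 8, 6), (1, 8, 10, 8, 10), (1, 9, 0, 9, 0), (1, 9, 1, 9, 1), (1, 9, 3, 9, 3),
   (1, 9, 6, 9, 6), (1, 9, 13, 9, 13), (1, 10, 5, 10, 5), (1, 10, 8, 10, 8), (1, 11, 2, 11, 2),
   (1, 11, 4, 11, 4), (1, 12, 0, 12, 0), (1, 12, 1, 12, 1), (1, 12, 2, 12, 2), (1, 12, 3, 12, 3),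
   (1, 12, 6, 12, 6), (1, 12, 13, 12, 13), (1, 13, 0, 13, 0), (1, 13, 1, 13, 1),
   (1, 13, 7, 13, 7), (1, 13, 9, 13, 9), (1, 13, 12, 13, 12), (2, 3, 4, 4, 4), (2, 4, 5, 5, 5),
   (2, 6, 4, 6, 3), (2, 6, 7, 2, 3), (2, 7, 11, 7, 12), (2, 8, 0, 8, 8), (2, 9, 0, 9, 8),
   (2, 9, 11, 9, 12), (2, 13, 4, 13, 3), (3, 4, 5, 3, 2), (3, 4, 11, 3, 13), (3, 6, 9, 7, 9),
   (3, 6, 12, 6, 13), (3, 8, 1, 8, 9), (3, 8, 5, 3, 6), (3, 9, 1, 9, 9), (3, 10, 8, 10, 10),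
   (3, 12, 1, 12, 9), (4, 11, 8, 11, 11), (4, 13, 11, 13, 13), (5, 12, 8, 12, 12),
   (6, 8, 5, 6, 6), (6, 13, 7, 9, 7), (7, 9, 6, 7, 7), (8, 13, 5, 13, 6), (9, 12, 6, 12, 7)]

/-- The elimination of a derivation matrix in characteristic two. -/
def eliminationStepsTwo : List (ℕ × ℕ × ℕ × ℕ × ℕ) :=
  [(0, 1, 2, 0, 2), (0, 1, 3, 1, 3), (0, 1, 4, 1, 4), (0, 1, 5, 1, 5), (0, 1, 6, 1, 6),
   (0, 1, 7, 0, 7), (0, 1, 8, 0, 8), (0, 1, 9, 1, 9), (0, 1, 10, 1, 10), (0, 1, 11, 1, 11),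
   (0, 1, 12, 1, 12), (0, 1, 13, 0, 13), (0, 2, 2, 0, 1), (0, 2, 3, 2, 3), (0, 2, 4, 2, 4),
   (0, 2, 5, 2, 5), (0, 2, 6, 2, 6), (0, 2, 9, 2, 9), (0, 2, 10, 2, 10), (0, 2, 11, 2, 11),
   (0, 2, 12, 2, 12), (0, 3, 0, 3, 0), (0, 3, 1, 3, 1), (0, 3, 2, 3, 2), (0, 3, 3, 0, 0),
   (0, 3, 7, 3, 7), (0, 3, 8, 3, 8), (0, 3, 13, 3, 13), (0, 4, 0, 4, 0), (0, 4, 1, 4, 1),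
   (0, 4, 2, 4, 2), (0, 4, 7, 4, 7), (0, 4, 8, 4, 8), (0, 4, 13, 4, 13), (0, 5, 0, 5, 0),
   (0, 5, 1, 5, 1), (0, 5, 2, 5, 2), (0, 5, 7, 5, 7), (0, 5, 8, 5, 8), (0, 5, 13, 5, 13),
   (0, 6, 0, 6, 0), (0, 6, 1, 6, 1), (0, 6, 2, 6, 2), (0, 6, 7, 6, 7), (0, 6, 8, 6, 8),
   (0, 6, 13, 6, 13), (0, 7, 3, 7, 3), (0, 7, 4, 7, 4), (0, 7, 5, 7, 5), (0, 7, 6, 7, 6),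
   (0, 7, 9, 7, 9), (0, 7, 10, 7, 10), (0, 7, 11, 7, 11), (0, 7, 12, 7, 12), (0, 8, 3, 8, 3),
   (0, 8, 4, 8, 4), (0, 8, 5, 8, 5), (0, 8, 6, 8, 6), (0, 8, 9, 8, 9), (0, 8, 10, 8, 10),
   (0, 8, 11, 8, 11), (0, 8, 12, 8, 12), (0, 9, 0, 9, 0), (0, 9, 1, 9, 1), (0, 9, 2, 9, 2),
   (0, 9, 7, 9, 7), (0, 9, 8, 9, 8), (0, 9, 13, 9, 13), (0, 10, 0, 10, 0), (0, 10, 1, 10, 1),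
   (0, 10, 2, 10, 2), (0, 10, 7, 10, 7), (0, 10, 8, 10, 8), (0, 10, 13, 10, 13),
   (0, 11, 0, 11, 0), (0, 11, 1, 11, 1), (0, 11, 2, 11, 2), (0, 11, 7, 11, 7), (0, 11, 8, 11, 8),
   (0, 11, 13, 11, 13), (0, 12, 0, 12, 0), (0, 12, 1, 12, 1), (0, 12, 2, 12, 2),
   (0, 12, 7, 12, 7), (0, 12, 8, 12, 8), (0, 12, 13, 12, 13), (0, 13, 3, 13, 3),
   (0, 13, 4, 13, 4), (0, 13, 5, 13, 5), (0, 13, 6, 13, 6), (0, 13, 9, 13, 9),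
   (0, 13, 10, 13, 10), (0, 13, 11, 13, 11), (0, 13, 12, 13, 12), (1, 2, 0, 2, 0),
   (1, 2, 1, 2, 1), (1, 2, 2, 1, 1), (1, 3, 3, 1, 0), (1, 3, 4, 3, 4), (1, 3, 6, 3, 6),
   (1, 3, 10, 3, 10), (1, 3, 12, 3, 12), (1, 4, 3, 4, 3), (1, 4, 5, 4, 5), (1, 4, 9, 4, 9),
   (1, 4, 11, 4, 11), (1, 5, 4, 5, 4), (1, 5, 6, 5, 6), (1, 5, 10, 5, 10), (1, 5, 12, 5, 12),
   (1, 6, 3, 6, 3), (1, 6, 5, 6, 5), (1, 6, 9, 6, 9), (1, 6, 11, 6, 11), (1, 7, 0, 7, 0),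
   (1, 7, 1, 7, 1), (1, 8, 0, 8, 0), (1, 8, 1, 8, 1), (1, 9, 4, 9, 4), (1, 9, 6, 9, 6),
   (1, 9, 10, 9, 10), (1, 9, 12, 9, 12), (1, 10, 3, 10, 3), (1, 10, 5, 10, 5), (1, 10, 9, 10, 9),
   (1, 10, 11, 10, 11), (1, 11, 4, 11, 4), (1, 11, 6, 11, 6), (1, 11, 10, 11, 10),
   (1, 11, 12, 11, 12), (1, 12, 3, 12, 3), (1, 12, 5, 12, 5), (1, 12, 9, 12, 9),
   (1, 12, 11, 12, 11), (1, 13, 0, 13, 0), (1, 13, 1, 13, 1), (2, 3, 4, 4, 4), (2, 3, 6, 4, 6),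
   (2, 3, 10, 4, 10), (2, 3, 12, 4, 12), (2, 4, 3, 2, 8), (2, 5, 4, 6, 4), (2, 5, 6, 6, 6),
   (2, 5, 10, 6, 10), (2, 5, 12, 6, 12), (2, 7, 0, 7, 8), (2, 8, 0, 8, 8), (2, 9, 4, 9, 3),
   (2, 9, 6, 9, 5), (2, 11, 4, 11, 3), (2, 11, 6, 11, 5), (2, 13, 0, 13, 8), (3, 4, 2, 3, 9),
   (3, 5, 1, 5, 9), (3, 6, 2, 7, 2), (3, 6, 7, 7, 7), (3, 6, 13, 7, 13), (3, 8, 4, 8, 2),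
   (3, 8, 12, 8, 13), (3, 9, 1, 9, 9), (3, 10, 7, 10, 6), (3, 10, 8, 10, 10), (3, 11, 1, 11, 9),
   (3, 12, 7, 12, 6), (3, 12, 8, 12, 10), (5, 6, 2, 5, 11), (5, 9, 1, 9, 11), (5, 10, 7, 10, 4),
   (5, 10, 8, 10, 12), (5, 11, 1, 11, 11), (5, 12, 7, 12, 4), (5, 12, 8, 12, 12),
   (5, 13, 6, 13, 2), (5, 13, 10, 13, 13), (9, 12, 7, 13, 7)]

theorem IsDerivationMatrix.eq_zero {F : Type*} [Field F] (h2 : (2 : F) ≠ 0)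
    {d : Fin 14 × Fin 14 → F} (hd : IsDerivationMatrix d) (h : ∀ i, d (positions i) = 0) :
    d = 0 := by
  refine hd.eq_zero_of_eliminates (vanishes := fun n => n == 0)
    (isUnit := fun n => n.natAbs == 1 || n.natAbs == 2 || n.natAbs == 4) (fun n hn => ?_)
    (fun n hn => ?_) eliminationSteps (List.ofFn positions)
    (by simpa only [List.forall_mem_ofFn_iff] using h)
    (by decide +kernel)
  · simp_all
  · have h4 : (4 : F) ≠ 0 := by
      rw [show (4 : F) = 2 * 2 by norm_num]; exact mul_ne_zero h2 h2
    simp only [Bool.or_eq_true, beq_iff_eq, Int.natAbs_eq_iff] at hn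
    rcases hn with ((rfl | rfl) | (rfl | rfl)) | (rfl | rfl) <;> simp [h2, h4]

theorem IsDerivationMatrix.eq_zero_of_charTwo {F : Type*} [Field F] [CharP F 2]
    {d : Fin 14 × Fin 14 → F} (hd : IsDerivationMatrix d) (h : ∀ i, d (positionsTwo i) = 0) :
    d = 0 := by
  refine hd.eq_zero_of_eliminates (vanishes := fun n => n % 2 == 0)
    (isUnit := fun n => n % 2 == 1) (fun n hn => ?_)
    (fun n hn => ?_) eliminationStepsTwo (List.ofFn positionsTwo)
    (by simpa only [List.forall_mem_ofFn_iff] using h) (by decide +kernel)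
  · rw [CharP.intCast_eq_zero_iff F 2]
    exact Int.dvd_of_emod_eq_zero (by simpa using hn)
  · rw [Ne, CharP.intCast_eq_zero_iff F 2]
    have : n % 2 = 1 := by simpa using hn
    push_cast
    omega

/-- Sets of matrix positions whose indicator functions are a basis of the derivation matrices of
`𝔤₂` in characteristic two. -/
def outerSupport : Fin 21 → List (Fin 14 × Fin 14) :=
  ![[(2, 13), (4, 12), (6, 10), (7, 8)],
    [(1, 13), (3, 12), (4, 11), (5, 10), (6, 9), (7, 0)],
    [(0, 12), (1, 12), (2, 11), (5, 8), (6, 0), (6, 1), (7, 3), (9, 13)],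
    [(3, 11), (5, 9), (7, 2), (8, 13)],
    [(0, 11), (5, 1), (6, 2), (7, 4), (8, 12), (10, 13)],
    [(5, 3), (6, 4), (9, 11), (10, 12)],
    [(0, 10), (1, 10), (2, 9), (3, 8), (4, 0), (4, 1), (7, 5), (11, 13)],
    [(1, 8), (2, 0), (4, 3), (6, 5), (9, 10), (11, 12)],
    [(0, 9), (3, 1), (4, 2), (7, 6), (8, 10), (12, 13)],
    [(2, 2), (4, 4), (6, 6), (7, 7), (8, 8), (10, 10), (12, 12), (13, 13)],
    [(3, 3), (4, 4), (7, 7), (9, 9), (10, 10), (13, 13)],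
    [(5, 5), (6, 6), (7, 7), (11, 11), (12, 12), (13, 13)],
    [(0, 3), (2, 4), (6, 7), (9, 1), (10, 8), (13, 12)],
    [(1, 2), (3, 4), (5, 6), (8, 0), (10, 9), (12, 11)],
    [(0, 4), (1, 4), (5, 7), (8, 3), (9, 2), (10, 0), (10, 1), (13, 11)],
    [(3, 5), (4, 6), (11, 9), (12, 10)],
    [(0, 5), (2, 6), (4, 7), (11, 1), (12, 8), (13, 10)],
    [(2, 7), (9, 5), (11, 3), (13, 8)],
    [(0, 6), (1, 6), (3, 7), (8, 5), (11, 2), (12, 0), (12, 1), (13, 9)],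
    [(1, 7), (9, 6), (10, 5), (11, 4), (12, 3), (13, 0)],
    [(8, 7), (10, 6), (12, 4), (13, 2)]]

/-- The bits of this number are the parities of the coordinates of a bracket. -/
def bracketMask (i j : Fin 14) : ℕ :=
  ((G2.table.getD i []).getD j []).foldr (fun e m => if e.2 % 2 = 0 then m else 2 ^ e.1 ^^^ m) 0

/-- The bits of this number are the parities of the coefficients `leibnizCoeff a b s v`. -/
def leibnizMask (a b : Fin 14) (v : Fin 14 × Fin 14) : ℕ :=
  (if (bracketMask a b).testBit v.1 then 2 ^ (v.2 : ℕ) else 0) ^^^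
    ((if v.1 = b then bracketMask a v.2 else 0) ^^^ (if v.1 = a then bracketMask v.2 b else 0))

/-- The image of a parity in a field of characteristic two. -/
def parity (F : Type*) [Field F] (b : Bool) : F := if b then 1 else 0

section CharTwo

variable {F : Type*} [Field F] [CharP F 2]

theorem intCast_eq_parity {n : ℤ} {b : Bool} (h : n % 2 = if b then 1 else 0) :
    (n : F) = parity F b := by
  have := (CharP.intCast_eq_intCast F 2 (a := n) (b := if b then 1 else 0)).2
    (by rw [Int.ModEq, Nat.cast_ofNat, h]; cases b <;> rfl)
  rw [this, parity]
  cases b <;> simp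

theorem parity_xor (a b : Bool) : parity F (a ^^ b) = parity F a + parity F b := by
  cases a <;> cases b <;> simp [parity, CharTwo.add_self_eq_zero]

theorem structureConst_eq_parity (i j s : Fin 14) :
    (structureConst i j s : F) = parity F ((bracketMask i j).testBit s) := by
  refine intCast_eq_parity ?_
  revert i j s
  decide +kernel

theorem leibnizCoeff_eq_parity (a b s : Fin 14) (v : Fin 14 × Fin 14) :
    (leibnizCoeff a b s v : F) = parity F ((leibnizMask a b v).testBit s) := by
  have h₁ : ((if v.2 = s then structureConst a b v.1 else 0 : ℤ) : F) = parity F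
      ((if (bracketMask a b).testBit v.1 then 2 ^ (v.2 : ℕ) else 0 : ℕ).testBit s) := by
    split_ifs with h h' h'
    · subst h; rw [structureConst_eq_parity, h', Nat.testBit_two_pow_self]
    · subst h; simp [structureConst_eq_parity, h', parity]
    · rw [Nat.testBit_two_pow_of_ne (fun e => h (Fin.ext e))]; simp [parity]
    · simp [parity]
  have h₂ : ((if v.1 = b then structureConst a v.2 s else 0 : ℤ) : F) = parity F
      ((if v.1 = b then bracketMask a v.2 else 0 : ℕ).testBit s) := by
    split_ifs
    · exact structureConst_eq_parity _ _ _
    · simp [parity]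
  have h₃ : ((if v.1 = a then structureConst v.2 b s else 0 : ℤ) : F) = parity F
      ((if v.1 = a then bracketMask v.2 b else 0 : ℕ).testBit s) := by
    split_ifs
    · exact structureConst_eq_parity _ _ _
    · simp [parity]
  rw [leibnizCoeff, Int.cast_sub, Int.cast_sub, h₁, h₂, h₃, leibnizMask, Nat.testBit_xor,
    Nat.testBit_xor, parity_xor, parity_xor, CharTwo.sub_eq_add, CharTwo.sub_eq_add, add_assoc]

theorem sum_leibnizCoeff_eq_parity (a b s : Fin 14) (l : List (Fin 14 × Fin 14)) :
    (((l.map (leibnizCoeff a b s)).sum : ℤ) : F) =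
      parity F ((l.foldr (fun v m => leibnizMask a b v ^^^ m) 0).testBit s) := by
  induction l with
  | nil => simp [parity]
  | cons v l ih =>
    rw [List.map_cons, List.sum_cons, Int.cast_add, ih, leibnizCoeff_eq_parity, List.foldr_cons,
      Nat.testBit_xor, parity_xor]

theorem leibnizMask_outerSupport (u : Fin 21) (a b : Fin 14) :
    (outerSupport u).foldr (fun v m => leibnizMask a b v ^^^ m) 0 = 0 := by
  revert u a b
  decide +kernel

theorem sum_leibnizCoeff_outerSupport (u : Fin 21) (a b s : Fin 14) :
    ((((outerSupport u).map (leibnizCoeff a b s)).sum : ℤ) : F) = 0 := by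
  rw [sum_leibnizCoeff_eq_parity, leibnizMask_outerSupport]
  simp [parity]

end CharTwo

theorem positionsTwo_mem_outerSupport_iff (u v : Fin 21) :
    positionsTwo v ∈ outerSupport u ↔ v = u := by
  revert u v
  decide +kernel

theorem nodup_outerSupport (u : Fin 21) : (outerSupport u).Nodup := by
  revert u
  decide +kernel

/-- Linear combinations of the basis of the derivation matrices in characteristic two. -/
def combination {F : Type*} [Ring F] (f : Fin 21 → F) (v : Fin 14 × Fin 14) : F :=
  ∑ u, if v ∈ outerSupport u then f u else 0

theorem combination_positionsTwo {F : Type*} [Ring F] (f : Fin 21 → F) (u : Fin 21) :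
    combination f (positionsTwo u) = f u := by
  simp [combination, positionsTwo_mem_outerSupport_iff]

theorem isDerivationMatrix_combination {F : Type*} [Field F] [CharP F 2] (f : Fin 21 → F) :
    IsDerivationMatrix (combination f) := by
  intro a b s
  simp only [combination, Finset.mul_sum]
  rw [Finset.sum_comm]
  refine Finset.sum_eq_zero fun u _ => ?_
  have h := sum_leibnizCoeff_outerSupport (F := F) u a b s
  rw [← List.sum_toFinset _ (nodup_outerSupport u), Int.cast_sum] at h
  simp only [mul_ite, mul_zero]
  rw [← Finset.sum_filter, ← Finset.sum_mul, ← zero_mul (f u), ← h]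
  congr 2
  ext v
  simp

end G2

namespace G2

/-- Positions in the matrices of `ad xᵢ` from which the `j`-th coordinate of an element can be
recovered. -/
def centerRow (j : Fin 14) : (Fin 14 × Fin 14) × (Fin 14 × Fin 14) :=
  if j < 2 then ((2, 2), (3, 3)) else ((0, j), (1, j))

/-- The coefficients of the recovery of the `j`-th coordinate. -/
def centerCoeff : Fin 14 → ℤ × ℤ :=
  ![(-2, -1), (-3, -2), (0, -1), (1, 2), (0, 1), (1, 0), (0, -1), (0, 1),
    (0, 1), (-1, -2), (0, -1), (-1, 0), (0, 1), (0, -1)]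

theorem centerCoeff_spec (j l : Fin 14) :
    (centerCoeff j).1 * structureConst (centerRow j).1.1 l (centerRow j).1.2 +
      (centerCoeff j).2 * structureConst (centerRow j).2.1 l (centerRow j).2.2 =
        if l = j then 1 else 0 := by
  revert j l
  decide +kernel

/-- A basis of a Lie algebra whose multiplication table is that of `𝔤₂`. -/
def IsStandardBasis {F 𝔤 : Type*} [Field F] [LieRing 𝔤] [LieAlgebra F 𝔤]
    (b : Module.Basis (Fin 14) F 𝔤) : Prop :=
  ∀ i j, ⁅b i, b j⁆ = ∑ t, (structureConst i j t : F) • b t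

/-- The matrix of a derivation, as a linear map. -/
noncomputable def derivationMatrix {F 𝔤 : Type*} [Field F] [LieRing 𝔤] [LieAlgebra F 𝔤]
    (b : Module.Basis (Fin 14) F 𝔤) : LieDerivation F 𝔤 𝔤 →ₗ[F] Fin 14 × Fin 14 → F where
  toFun D v := b.repr (D (b v.1)) v.2
  map_add' D E := by ext v; simp
  map_smul' r D := by ext v; simp

namespace IsStandardBasis

variable {F 𝔤 : Type*} [Field F] [LieRing 𝔤] [LieAlgebra F 𝔤] {b : Module.Basis (Fin 14) F 𝔤}

theorem repr_lie (hb : IsStandardBasis b) (x y : 𝔤) (s : Fin 14) :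
    b.repr ⁅x, y⁆ s = ∑ i, ∑ j, b.repr x i * b.repr y j * structureConst i j s := by
  conv_lhs => rw [← b.sum_repr x, ← b.sum_repr y]
  simp only [sum_lie, lie_sum, smul_lie, lie_smul, hb _ _, map_sum, map_smul,
    Finsupp.coe_finsetSum, Finsupp.coe_smul, Finset.sum_apply, Pi.smul_apply, smul_eq_mul,
    b.repr_self_apply, mul_ite, mul_one, mul_zero, Finset.sum_ite_eq', Finset.mem_univ, if_true]
  rw [Finset.sum_comm]
  refine Finset.sum_congr rfl fun j _ => ?_
  rw [Finset.mul_sum]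
  refine Finset.sum_congr rfl fun i _ => ?_
  ring

theorem sum_leibnizCoeff_mul (d : Fin 14 × Fin 14 → F) (i j s : Fin 14) :
    ∑ v, (leibnizCoeff i j s v : F) * d v =
      ∑ t, structureConst i j t * d (t, s) - ∑ t, d (j, t) * structureConst i t s -
        ∑ t, d (i, t) * structureConst t j s := by
  rw [Fintype.sum_prod_type]
  simp only [leibnizCoeff, Int.cast_sub, Int.cast_ite, Int.cast_zero, sub_mul, ite_mul, zero_mul,
    Finset.sum_sub_distrib, Finset.sum_ite_eq', Finset.mem_univ, if_true]
  congr 1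
  · congr 1
    rw [Finset.sum_comm]
    simp [mul_comm]
  · rw [Finset.sum_comm]
    simp [mul_comm]

theorem isDerivationMatrix (hb : IsStandardBasis b) (D : LieDerivation F 𝔤 𝔤) :
    IsDerivationMatrix (derivationMatrix b D) := by
  intro i j s
  have h := congrArg (fun x => b.repr x s) (D.apply_lie_eq_add (b i) (b j))
  simp only [map_add, Finsupp.add_apply, hb.repr_lie (b i), hb.repr_lie (D (b i))] at h
  rw [hb i j] at h
  simp only [map_sum, map_smul, Finsupp.coe_finsetSum, Finset.sum_apply, Finsupp.coe_smul,
    Pi.smul_apply, smul_eq_mul, b.repr_self_apply, ite_mul, mul_ite, one_mul, mul_one, mul_zero,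
    zero_mul] at h
  simp at h
  rw [sum_leibnizCoeff_mul]
  simp only [derivationMatrix, LinearMap.coe_mk, AddHom.coe_mk]
  rw [h]
  ring

theorem derivationMatrix_injective : Function.Injective (derivationMatrix b) := by
  intro D E h
  refine LieDerivation.ext fun x => ?_
  have : (D : 𝔤 →ₗ[F] 𝔤) = E := b.ext fun i => b.ext_elem fun j => congrFun h (i, j)
  exact LinearMap.congr_fun this x

/-- A solution of the Leibniz equations is the matrix of a derivation. -/
theorem exists_derivationMatrix_eq (hb : IsStandardBasis b) {d : Fin 14 × Fin 14 → F}
    (hd : IsDerivationMatrix d) : ∃ D, derivationMatrix b D = d := by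
  let f : 𝔤 →ₗ[F] 𝔤 := b.constr F fun i => ∑ j, d (i, j) • b j
  have hf (i) : f (b i) = ∑ j, d (i, j) • b j := b.constr_basis F _ i
  have hfr (i s) : b.repr (f (b i)) s = d (i, s) := by
    rw [hf, b.repr_sum_self]
  have key (x y : 𝔤) : f ⁅x, y⁆ = ⁅x, f y⁆ - ⁅y, f x⁆ := by
    let B₁ : 𝔤 →ₗ[F] 𝔤 →ₗ[F] 𝔤 := (LieModule.toEnd F 𝔤 𝔤 : 𝔤 →ₗ[F] Module.End F 𝔤).compr₂ f
    let B₂ : 𝔤 →ₗ[F] 𝔤 →ₗ[F] 𝔤 := (LieModule.toEnd F 𝔤 𝔤 : 𝔤 →ₗ[F] Module.End F 𝔤).compl₂ f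
    have : B₁ = B₂ - B₂.flip := by
      refine b.ext fun i => b.ext fun j => b.ext_elem fun s => ?_
      have h := hd i j s
      rw [sum_leibnizCoeff_mul] at h
      change b.repr (f ⁅b i, b j⁆) s = b.repr (⁅b i, f (b j)⁆ - ⁅b j, f (b i)⁆) s
      rw [← lie_skew (b j), sub_neg_eq_add, map_add, Finsupp.add_apply, hb.repr_lie (b i),
        hb.repr_lie (f (b i)), hb i j]
      simp only [map_sum, map_smul, Finsupp.coe_finsetSum, Finset.sum_apply, Finsupp.coe_smul,
        Pi.smul_apply, smul_eq_mul, b.repr_self_apply, ite_mul, mul_ite, one_mul, mul_one, mul_zero,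
        zero_mul, hfr]
      simp
      linear_combination h
    exact LinearMap.congr_fun₂ this x y
  refine ⟨⟨f, key⟩, ?_⟩
  ext v
  exact hfr v.1 v.2

theorem finrank_eq (b : Module.Basis (Fin 14) F 𝔤) : Module.finrank F 𝔤 = 14 := by
  rw [Module.finrank_eq_card_basis b, Fintype.card_fin]

/-- The center is trivial, in every characteristic. -/
theorem center_eq_bot (hb : IsStandardBasis b) : LieAlgebra.center F 𝔤 = ⊥ := by
  rw [eq_bot_iff]
  intro x hx
  have h (i s : Fin 14) : ∑ j, (b.repr x j) * (structureConst i j s : F) = 0 := by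
    have h := congrArg (fun y => b.repr y s) ((LieModule.mem_maxTrivSubmodule F 𝔤 𝔤 x).1 hx (b i))
    simp only [hb.repr_lie, b.repr_self_apply, map_zero, Finsupp.zero_apply] at h
    simpa [ite_mul] using h
  refine (LieSubmodule.mem_bot x).2 (b.ext_elem fun j => ?_)
  have key := centerCoeff_spec j
  set r := centerRow j
  calc b.repr x j = ∑ l, b.repr x l * ((if l = j then 1 else 0 : ℤ) : F) := by simp
    _ = (centerCoeff j).1 * ∑ l, b.repr x l * (structureConst r.1.1 l r.1.2 : F) +
        (centerCoeff j).2 * ∑ l, b.repr x l * (structureConst r.2.1 l r.2.2 : F) := by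
      rw [Finset.mul_sum, Finset.mul_sum, ← Finset.sum_add_distrib]
      refine Finset.sum_congr rfl fun l _ => ?_
      rw [← key l]
      push_cast
      ring
    _ = b.repr 0 j := by simp [h]

theorem finiteDimensional_derivation (b : Module.Basis (Fin 14) F 𝔤) :
    FiniteDimensional F (LieDerivation F 𝔤 𝔤) :=
  FiniteDimensional.of_injective _ (derivationMatrix_injective (b := b))

theorem finrank_derivation_le (hb : IsStandardBasis b) (h2 : (2 : F) ≠ 0) :
    Module.finrank F (LieDerivation F 𝔤 𝔤) ≤ 14 := by
  have : Function.Injective ((LinearMap.funLeft F F positions).comp (derivationMatrix b)) := by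
    rw [← LinearMap.ker_eq_bot, LinearMap.ker_eq_bot']
    intro D hD
    refine (map_eq_zero_iff _ (derivationMatrix_injective (b := b))).1 ?_
    exact (hb.isDerivationMatrix D).eq_zero h2 fun i => congrFun hD i
  simpa using LinearMap.finrank_le_finrank_of_injective this

theorem finrank_derivation_of_charTwo (hb : IsStandardBasis b) [CharP F 2] :
    Module.finrank F (LieDerivation F 𝔤 𝔤) = 21 := by
  let φ := (LinearMap.funLeft F F positionsTwo).comp (derivationMatrix b)
  have hφ : Function.Bijective φ := by
    constructor
    · rw [← LinearMap.ker_eq_bot, LinearMap.ker_eq_bot']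
      intro D hD
      refine (map_eq_zero_iff _ (derivationMatrix_injective (b := b))).1 ?_
      exact (hb.isDerivationMatrix D).eq_zero_of_charTwo fun i => congrFun hD i
    · intro f
      obtain ⟨D, hD⟩ := hb.exists_derivationMatrix_eq (isDerivationMatrix_combination f)
      refine ⟨D, funext fun u => ?_⟩
      change derivationMatrix b D (positionsTwo u) = f u
      rw [hD, combination_positionsTwo]
  simpa using (LinearEquiv.ofBijective φ hφ).finrank_eq

theorem ad_injective (hb : IsStandardBasis b) : Function.Injective (LieDerivation.ad F 𝔤) := by
  rw [← LieHom.ker_eq_bot, LieDerivation.ad_ker_eq_center, hb.center_eq_bot]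

theorem forall_derivation_inner_iff (hb : IsStandardBasis b) (p : ℕ) [Fact p.Prime] [CharP F p] :
    (∀ D : LieDerivation F 𝔤 𝔤, ∃ x : 𝔤, ∀ y : 𝔤, D y = ⁅x, y⁆) ↔ p ≠ 2 := by
  have : Module.Finite F 𝔤 := .of_basis b
  have : Module.Finite F (LieDerivation F 𝔤 𝔤) := finiteDimensional_derivation b
  have hinj : Function.Injective (LieDerivation.ad F 𝔤 : 𝔤 →ₗ[F] LieDerivation F 𝔤 𝔤) :=
    hb.ad_injective
  constructor
  · rintro h rfl
    have hsurj : Function.Surjective (LieDerivation.ad F 𝔤 : 𝔤 →ₗ[F] LieDerivation F 𝔤 𝔤) := by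
      intro D
      obtain ⟨x, hx⟩ := h D
      exact ⟨x, LieDerivation.ext fun y => (LieDerivation.ad_apply_apply F 𝔤 x y).trans (hx y).symm⟩
    have := (LinearEquiv.ofBijective _ ⟨hinj, hsurj⟩).finrank_eq
    rw [finrank_eq b, hb.finrank_derivation_of_charTwo] at this
    omega
  · intro hp D
    have h2 : (2 : F) ≠ 0 := Ring.two_ne_zero (by rwa [ringChar.eq F p])
    have hle := LinearMap.finrank_le_finrank_of_injective hinj
    have hrank : Module.finrank F 𝔤 = Module.finrank F (LieDerivation F 𝔤 𝔤) :=
      le_antisymm hle ((hb.finrank_derivation_le h2).trans_eq (finrank_eq b).symm)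
    obtain ⟨x, hx⟩ := (LinearMap.injective_iff_surjective_of_finrank_eq_finrank hrank).1 hinj D
    exact ⟨x, fun y => by rw [← hx]; exact LieDerivation.ad_apply_apply F 𝔤 x y⟩

end IsStandardBasis

end G2

namespace ChevalleyBasis

open LieAlgebra.IsKilling

variable {k L : Type*} [Field k] [IsAlgClosed k] [CharZero k] [LieRing L]
  [LieAlgebra k L] [FiniteDimensional k L] [LieAlgebra.IsSemisimple k L]
  {H : LieSubalgebra k L} [H.IsCartanSubalgebra] (C : ChevalleyBasis H)
  [(rootSystem H).EmbeddedG2] [(rootSystem H).IsIrreducible]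

theorem isStandardBasis_baseChange (F : Type*) [Field F] :
    G2.IsStandardBasis (C.integralBasis.baseChange F) := by
  intro i j
  simp only [Module.Basis.baseChange_apply, LieAlgebra.ExtendScalars.bracket_tmul, mul_one,
    lie_integralBasis, TensorProduct.tmul_sum, TensorProduct.tmul_smul, Int.cast_smul_eq_zsmul]

end ChevalleyBasis

theorem mainTheorem5 {k L : Type*} [Field k] [IsAlgClosed k] [CharZero k]
    [LieRing L] [LieAlgebra k L] [FiniteDimensional k L] [LieAlgebra.IsSimple k L]
    (H : LieSubalgebra k L) [H.IsCartanSubalgebra]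
    (hG2 : (LieAlgebra.IsKilling.rootSystem H).IsG2) (C : ChevalleyBasis H)
    {F : Type*} [Field F] (p : ℕ) [Fact p.Prime] [CharP F p] :
    Module.finrank F (C.chevalleyAlgebra F) = 14 ∧
    ((∀ D : LieDerivation F (C.chevalleyAlgebra F) (C.chevalleyAlgebra F),
        ∃ x : C.chevalleyAlgebra F, ∀ y : C.chevalleyAlgebra F, D y = ⁅x, y⁆) ↔ p ≠ 2) ∧
    (p = 2 →
      LieAlgebra.center F (C.chevalleyAlgebra F) = ⊥ ∧
      Module.finrank F
        (LieDerivation F (C.chevalleyAlgebra F) (C.chevalleyAlgebra F)) = 21) := by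
  let _ : (LieAlgebra.IsKilling.rootSystem H).EmbeddedG2 :=
    RootPairing.IsG2.toEmbeddedG2 _
  have hb : G2.IsStandardBasis (C.integralBasis.baseChange F) := C.isStandardBasis_baseChange F
  refine ⟨G2.IsStandardBasis.finrank_eq (C.integralBasis.baseChange F),
    hb.forall_derivation_inner_iff p, ?_⟩
  rintro rfl
  exact ⟨hb.center_eq_bot, hb.finrank_derivation_of_charTwo⟩
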